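/- Let $(M,g)$ be a compact Kähler manifold without boundary, of complex dimension $m\ge 2$. In local holomorphic coordinates write $\phi_{i\bar j}=\partial^2\phi/\partial z^i\partial\bar z^j$, $\Delta\phi=g^{i\bar j}\phi_{i\bar j}$ and $R_{i\bar jk\bar l}=-\partial_k\partial_{\bar l}g_{i\bar j}+g^{p\bar q}\,\partial_kg_{i\bar q}\,\partial_{\bar l}g_{p\bar j}$. Suppose that $(M,g)$ has nonnegative orthogonal bisectional curvature, that is, for every $p\in M$ and every unitary basis $e_1,\dots,e_m$ of the holomorphic tangent space at $p$ we have $R(e_i,\overline{e_i},e_j,\overline{e_j})\ge 0$ for all $i\ne j$. Then for all real numbers $L$, $A$, $\Lambda$ there is a constant $C$, depending only on $(M,g)$, $L$, $A$ and $\Lambda$, with the following property. Let $f:M\to\mathbb R$ satisfy $f>0$, $\sup_M f\le\Lambda$ and $\inf_M\Delta f^{1/(m-1)}\ge -A$, and let $\phi\in C^4(M)$ be a real-valued function with $\sup_M\phi-\inf_M\phi\le L$ that solves the complex Monge–Ampère equation $$\det(g_{i\bar j}+\phi_{i\bar j})=f\,\det(g_{i\bar j})$$ and for which $(g_{i\bar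 j}+\phi_{i\bar j})$ is positive definite everywhere. Then $|\Delta\phi|\le C$ on $M$. -/

import Mathlib

open scoped Manifold ContDiff ComplexConjugate ComplexOrder

noncomputable section

/-- The model space `ℂ^m`. -/
abbrev CSpace (m : ℕ) : Type := EuclideanSpace ℂ (Fin m)

/-- The Wirtinger derivative `∂F/∂z^i = (∂F/∂x^i - √-1 ∂F/∂y^i)/2` on `ℂ^m`. -/
def dz {m : ℕ} (i : Fin m) (F : CSpace m → ℂ) (z : CSpace m) : ℂ :=
  (fderiv ℝ F z (EuclideanSpace.single i 1) -
    Complex.I * fderiv ℝ F z (EuclideanSpace.single i Complex.I)) / 2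

/-- The Wirtinger derivative `∂F/∂z̄^i = (∂F/∂x^i + √-1 ∂F/∂y^i)/2` on `ℂ^m`. -/
def dzbar {m : ℕ} (i : Fin m) (F : CSpace m → ℂ) (z : CSpace m) : ℂ :=
  (fderiv ℝ F z (EuclideanSpace.single i 1) +
    Complex.I * fderiv ℝ F z (EuclideanSpace.single i Complex.I)) / 2

/-- The holomorphic coordinate vector `∂/∂z^i` of the chart `e`, at the point of `M` with
coordinates `z`. -/
def coordVec {m : ℕ} {M : Type*} [TopologicalSpace M] [ChartedSpace (CSpace m) M]
    (e : OpenPartialHomeomorph M (CSpace m)) (z : CSpace m) (i : Fin m) :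
    TangentSpace 𝓘(ℂ, CSpace m) (e.symm z) :=
  mfderiv 𝓘(ℂ, CSpace m) 𝓘(ℂ, CSpace m) e.symm z
    (EuclideanSpace.single i (1 : ℂ) : CSpace m)

/-- The components `g_{i j̄} = g(∂/∂z^i, ∂/∂z̄^j)` of a field of sesquilinear forms in the
chart `e`, as a function of the coordinates `z`. -/
def formMatrix {m : ℕ} {M : Type*} [TopologicalSpace M] [ChartedSpace (CSpace m) M]
    (h : ∀ x : M, TangentSpace 𝓘(ℂ, CSpace m) x →ₗ[ℂ]
      TangentSpace 𝓘(ℂ, CSpace m) x →ₗ⋆[ℂ] ℂ)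
    (e : OpenPartialHomeomorph M (CSpace m)) (z : CSpace m) : Matrix (Fin m) (Fin m) ℂ :=
  Matrix.of fun i j => h (e.symm z) (coordVec e z i) (coordVec e z j)

/-- A (smooth) Kähler metric on a complex manifold of dimension `m`: a smoothly varying positive
definite Hermitian form on the holomorphic tangent spaces, linear in the first and
conjugate-linear in the second argument, whose fundamental form is closed; in holomorphic
coordinates the last condition reads `∂_k g_{i j̄} = ∂_i g_{k j̄}`. -/
structure KahlerMetric (m : ℕ) (M : Type*) [TopologicalSpace M]
    [ChartedSpace (CSpace m) M] where
  form : ∀ x : M, TangentSpace 𝓘(ℂ, CSpace m) x →ₗ[ℂ]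
    TangentSpace 𝓘(ℂ, CSpace m) x →ₗ⋆[ℂ] ℂ
  conj_symm : ∀ (x : M) (u v : TangentSpace 𝓘(ℂ, CSpace m) x),
    conj (form x u v) = form x v u
  pos : ∀ (x : M) (v : TangentSpace 𝓘(ℂ, CSpace m) x), v ≠ 0 → 0 < (form x v v).re
  smooth : ∀ e ∈ atlas (CSpace m) M, ∀ i j : Fin m,
    ContDiffOn ℝ ∞ (fun z => formMatrix form e z i j) e.target
  closed : ∀ e ∈ atlas (CSpace m) M, ∀ z ∈ e.target, ∀ i j k : Fin m,
    dz k (fun w => formMatrix form e w i j) z = dz i (fun w => formMatrix form e w k j) z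

/-- The complex Hessian `u_{i j̄} = ∂²u/∂z^i∂z̄^j` of a real function `u` in the chart `e`. -/
def complexHessian {m : ℕ} {M : Type*} [TopologicalSpace M]
    (e : OpenPartialHomeomorph M (CSpace m)) (u : M → ℝ) (z : CSpace m) :
    Matrix (Fin m) (Fin m) ℂ :=
  Matrix.of fun i j => dz i (dzbar j fun w => ((u (e.symm w) : ℝ) : ℂ)) z

namespace KahlerMetric

variable {m : ℕ} {M : Type*} [TopologicalSpace M] [ChartedSpace (CSpace m) M]

/-- The matrix `(g_{i j̄})` of the metric in the chart `e`. -/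
def matrix (g : KahlerMetric m M) (e : OpenPartialHomeomorph M (CSpace m)) (z : CSpace m) :
    Matrix (Fin m) (Fin m) ℂ :=
  formMatrix g.form e z

/-- The curvature tensor in the chart `e`:
`R_{i j̄ k l̄} = - ∂_k ∂_l̄ g_{i j̄} + g^{p q̄} ∂_k g_{i q̄} ∂_l̄ g_{p j̄}`,
where `g^{p q̄}` is the `(q, p)` entry of the inverse matrix of `(g_{i j̄})`. -/
def curvature (g : KahlerMetric m M) (e : OpenPartialHomeomorph M (CSpace m)) (z : CSpace m)
    (i j k l : Fin m) : ℂ :=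
  -dz k (dzbar l fun w => g.matrix e w i j) z +
    ∑ p, ∑ q, (g.matrix e z)⁻¹ q p *
      dz k (fun w => g.matrix e w i q) z * dzbar l (fun w => g.matrix e w p j) z

/-- Nonnegative orthogonal bisectional curvature: `R(v_a, v̄_a, v_b, v̄_b) ≥ 0` for `a ≠ b` and
every unitary basis `v_1, …, v_m` of a holomorphic tangent space. The vectors are given by their
components in a chart. -/
def NonnegOrthogonalBisectional (g : KahlerMetric m M) : Prop :=
  ∀ e ∈ atlas (CSpace m) M, ∀ z ∈ e.target, ∀ v : Fin m → Fin m → ℂ,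
    (∀ a b, ∑ i, ∑ j, g.matrix e z i j * v a i * conj (v b j) = if a = b then 1 else 0) →
    ∀ a b, a ≠ b →
      0 ≤ (∑ i, ∑ j, ∑ k, ∑ l,
        g.curvature e z i j k l * v a i * conj (v a j) * v b k * conj (v b l)).re

/-- The Laplacian `Δu = g^{i j̄} u_{i j̄}`, computed at `x` in the preferred chart at `x`
(for `u` of class `C²` every holomorphic chart gives the same value, and the trace is real). -/
def laplacian (g : KahlerMetric m M) (u : M → ℝ) (x : M) : ℝ :=
  let e := chartAt (CSpace m) x
  ((g.matrix e (e x))⁻¹ * complexHessian e u (e x)).trace.re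

/-- The complex Monge-Ampère equation `det(g_{i j̄} + φ_{i j̄}) = f det(g_{i j̄})`, in local
holomorphic coordinates. -/
def SolvesMongeAmpere (g : KahlerMetric m M) (f φ : M → ℝ) : Prop :=
  ∀ e ∈ atlas (CSpace m) M, ∀ z ∈ e.target,
    (g.matrix e z + complexHessian e φ z).det = (f (e.symm z) : ℂ) * (g.matrix e z).det

/-- The Hermitian form `(g_{i j̄} + φ_{i j̄})` is positive definite everywhere. -/
def PosDefPotential (g : KahlerMetric m M) (φ : M → ℝ) : Prop :=
  ∀ e ∈ atlas (CSpace m) M, ∀ z ∈ e.target,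
    (g.matrix e z + complexHessian e φ z).PosDef

end KahlerMetric

end

/-! The estimate is a maximum principle for `u - δφ`, where `u = m + Δφ` is the trace of `W = (g_{i
j̄} + φ_{i j̄})` with respect to `g` and `δ > 0` is small. The difficulty is that no positive lower
bound for `f` is available, so the equation is written with `H = f^{1/(m-1)}`, and every division by
`H` has to be undone at the end.

In a frame with `g = 1` and `W = diag(μ)`, the fourth derivatives of `φ` are eliminated with the
twice differentiated equation. Then `∑ u_{k k̄}/μ_k` is a sum of three terms
(`sum_second_order_identity`): a curvature term, which after symmetrization is a sum of orthogonal
bisectional curvatures times `(μ_i - μ_k)²/(μ_i μ_k)`; the Laplacian of `log f`; and a sum of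
squares of covariant derivatives of `W`. The Laplacian of `log f = (m-1) log H` contains
`-(m-1)|∂H|²/H²`, which the squares must absorb. The plain inequality `|∑ x_k|² ≤ m ∑ |x_k|²` just
fails to do so. However, `∑ μ_k x_k` is the derivative of `u`; if it vanishes, `x` is orthogonal to
the positive vector `μ` and the constant improves from `m` to `m - 1`, exactly what is needed
(`normSq_sum_le`). In general the error is `|∂u|²` times a constant over `E = (∑ μ)² - ∑ μ²`. This
gives `sum_wirt_wirt_trace_ge`.

At a maximum of `u - δφ` one has `∂u = δ ∂φ`, so the error is controlled by `δ²|∂φ|²`. Interpolation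
on complex lines bounds `|∂φ|²` by a constant times `K = max u` (`norm_sq_wirt_le`,
`exists_gradientBound`). Since `K ≤ 2 ∑ μ` there, unless `K` is already bounded, and `∑ μ ≤ E ∑ 1/μ`
(`sum_le_mul_sum_inv`), a small `δ` lets half of the good term `δ ∑ 1/μ` absorb the error. What
remains bounds `H ∑ 1/μ`. As `∏ μ = H^{m-1}`, each `μ_i` is the product of the `m - 1` numbers
`H/μ_j`, `j ≠ i`, hence bounded (`le_pow_mul_sum_inv`), with no lower bound on `H`. -/

noncomputable section

open Filter Topology Matrix

/-! ### Wirtinger derivatives along arbitrary vectors -/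

section Wirtinger

variable {m : ℕ}

/-- The first order operator `F ↦ (∂_v F + c ∂_{√-1 v} F)/2`; for `c = -√-1` and `c = √-1` these are
the Wirtinger derivatives of `F` along `v`. -/
def wirt (c : ℂ) (v : CSpace m) (F : CSpace m → ℂ) (z : CSpace m) : ℂ :=
  (fderiv ℝ F z v + c * fderiv ℝ F z (Complex.I • v)) / 2

theorem single_I_eq_smul (i : Fin m) :
    (EuclideanSpace.single i Complex.I : CSpace m) =
      Complex.I • (EuclideanSpace.single i (1 : ℂ) : CSpace m) := by
  ext j
  by_cases h : j = i <;> simp [h]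

theorem dz_eq_wirt (i : Fin m) (F : CSpace m → ℂ) :
    dz i F = wirt (-Complex.I) (EuclideanSpace.single i 1) F := by
  funext z
  simp only [dz, wirt, single_I_eq_smul]
  ring

theorem dzbar_eq_wirt (i : Fin m) (F : CSpace m → ℂ) :
    dzbar i F = wirt Complex.I (EuclideanSpace.single i 1) F := by
  funext z
  simp only [dzbar, wirt, single_I_eq_smul]

variable {c c' : ℂ} {v w : CSpace m} {F F' : CSpace m → ℂ} {z : CSpace m}

theorem wirt_congr (h : F =ᶠ[𝓝 z] F') : wirt c v F z = wirt c v F' z := by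
  simp only [wirt, h.fderiv_eq]

theorem wirt_congr_eventually (h : F =ᶠ[𝓝 z] F') : wirt c v F =ᶠ[𝓝 z] wirt c v F' := by
  filter_upwards [h.eventuallyEq_nhds] with y hy using wirt_congr hy

theorem wirt_const (a : ℂ) : wirt c v (fun _ => a) z = 0 := by
  simp [wirt]

theorem wirt_add (hF : DifferentiableAt ℝ F z) (hF' : DifferentiableAt ℝ F' z) :
    wirt c v (fun y => F y + F' y) z = wirt c v F z + wirt c v F' z := by
  simp only [wirt, fderiv_fun_add hF hF', _root_.add_apply]
  ring

theorem wirt_neg : wirt c v (fun y => -F y) z = -wirt c v F z := by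
  simp only [wirt, fderiv_fun_neg, _root_.neg_apply]
  ring

theorem wirt_sub (hF : DifferentiableAt ℝ F z) (hF' : DifferentiableAt ℝ F' z) :
    wirt c v (fun y => F y - F' y) z = wirt c v F z - wirt c v F' z := by
  simp only [wirt, fderiv_fun_sub hF hF', _root_.sub_apply]
  ring

theorem wirt_mul (hF : DifferentiableAt ℝ F z) (hF' : DifferentiableAt ℝ F' z) :
    wirt c v (fun y => F y * F' y) z = wirt c v F z * F' z + F z * wirt c v F' z := by
  simp only [wirt, fderiv_fun_mul hF hF', _root_.add_apply,
    _root_.smul_apply, smul_eq_mul]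
  ring

theorem wirt_const_mul (a : ℂ) (hF : DifferentiableAt ℝ F z) :
    wirt c v (fun y => a * F y) z = a * wirt c v F z := by
  rw [wirt_mul (differentiableAt_const a) hF, wirt_const, zero_mul, zero_add]

theorem wirt_sum {ι : Type*} (s : Finset ι) {f : ι → CSpace m → ℂ}
    (hf : ∀ i ∈ s, DifferentiableAt ℝ (f i) z) :
    wirt c v (fun y => ∑ i ∈ s, f i y) z = ∑ i ∈ s, wirt c v (f i) z := by
  simp only [wirt, fderiv_fun_sum hf, _root_.sum_apply, Finset.mul_sum,
    ← Finset.sum_add_distrib, Finset.sum_div]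

theorem wirt_prod {ι : Type*} [DecidableEq ι] (s : Finset ι) {f : ι → CSpace m → ℂ}
    (hf : ∀ i ∈ s, DifferentiableAt ℝ (f i) z) :
    wirt c v (fun y => ∏ i ∈ s, f i y) z =
      ∑ i ∈ s, (∏ j ∈ s.erase i, f j z) * wirt c v (f i) z := by
  simp only [wirt, fderiv_finsetProd hf, _root_.sum_apply,
    _root_.smul_apply, smul_eq_mul, Finset.mul_sum,
    ← Finset.sum_add_distrib, Finset.sum_div]
  refine Finset.sum_congr rfl fun i _ => ?_
  ring

theorem wirt_pow (n : ℕ) (hF : DifferentiableAt ℝ F z) :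
    wirt c v (fun y => F y ^ n) z = n * F z ^ (n - 1) * wirt c v F z := by
  simp only [wirt, fderiv_fun_pow n hF, _root_.smul_apply, smul_eq_mul, nsmul_eq_mul]
  ring

theorem wirt_inv (hF : DifferentiableAt ℝ F z) (h0 : F z ≠ 0) :
    wirt c v (fun y => (F y)⁻¹) z = -wirt c v F z / F z ^ 2 := by
  have h1 : wirt c v (fun y => F y * (F y)⁻¹) z = 0 := by
    rw [← wirt_const (c := c) (v := v) (z := z) 1]
    apply wirt_congr
    filter_upwards [hF.continuousAt.eventually_ne h0] with y hy using mul_inv_cancel₀ hy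
  rw [wirt_mul (F' := fun y => (F y)⁻¹) hF (hF.inv h0)] at h1
  have h2 : F z * wirt c v (fun y => (F y)⁻¹) z = -(wirt c v F z * (F z)⁻¹) := by
    linear_combination h1
  apply mul_left_cancel₀ h0
  rw [h2]
  field_simp

theorem conj_wirt (hF : DifferentiableAt ℝ F z) :
    conj (wirt c v F z) = wirt (conj c) v (fun y => conj (F y)) z := by
  have h : HasFDerivAt (fun y => conj (F y))
      ((Complex.conjCLE : ℂ →L[ℝ] ℂ).comp (fderiv ℝ F z)) z :=
    (Complex.conjCLE : ℂ →L[ℝ] ℂ).hasFDerivAt.comp z hF.hasFDerivAt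
  simp [wirt, h.fderiv, Complex.conj_ofNat]

/-- Complex linearity in the direction holds only for `c = -√-1`, and conjugate linearity only for
`c = √-1`. These allow derivatives along frame vectors to be expanded in coordinate derivatives. -/
theorem wirt_vec_smul_holo (a : ℂ) :
    wirt (-Complex.I) (a • v) F z = a * wirt (-Complex.I) v F z := by
  have h1 : a • v = a.re • v + a.im • (Complex.I • v) := by
    conv_lhs => rw [← Complex.re_add_im a]
    rw [add_smul, mul_smul]; rfl
  have h2 : Complex.I • a • v = a.re • (Complex.I • v) - a.im • v := by
    rw [h1, smul_add, smul_comm, smul_comm Complex.I a.im, smul_smul Complex.I Complex.I]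
    simp [sub_eq_add_neg]
  rw [wirt, h2, h1]
  simp only [map_add, map_sub, map_smul, wirt, Complex.real_smul]
  conv_rhs => rw [← Complex.re_add_im a]
  linear_combination (a.im : ℂ) * fderiv ℝ F z (Complex.I • v) / 2 * Complex.I_sq

theorem wirt_vec_smul_anti (a : ℂ) :
    wirt Complex.I (a • v) F z = conj a * wirt Complex.I v F z := by
  have h1 : a • v = a.re • v + a.im • (Complex.I • v) := by
    conv_lhs => rw [← Complex.re_add_im a]
    rw [add_smul, mul_smul]; rfl
  have h2 : Complex.I • a • v = a.re • (Complex.I • v) - a.im • v := by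
    rw [h1, smul_add, smul_comm, smul_comm Complex.I a.im, smul_smul Complex.I Complex.I]
    simp [sub_eq_add_neg]
  rw [wirt, h2, h1]
  simp only [map_add, map_sub, map_smul, wirt, Complex.real_smul]
  conv_rhs => rw [← Complex.re_add_im a]
  simp only [map_add, map_mul, Complex.conj_ofReal, Complex.conj_I]
  linear_combination (a.im : ℂ) * fderiv ℝ F z (Complex.I • v) / 2 * Complex.I_sq

theorem vec_eq_sum_single (v : CSpace m) :
    v = ∑ i, v i • (EuclideanSpace.single i (1 : ℂ) : CSpace m) := by
  ext j
  simp [Pi.single_apply]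

theorem wirt_vec_sum {ι : Type*} (s : Finset ι) (f : ι → CSpace m) :
    wirt c (∑ i ∈ s, f i) F z = ∑ i ∈ s, wirt c (f i) F z := by
  simp only [wirt, Finset.smul_sum, map_sum, Finset.mul_sum, ← Finset.sum_add_distrib,
    Finset.sum_div]

theorem wirt_holo_eq_sum (v : CSpace m) (F : CSpace m → ℂ) (z : CSpace m) :
    wirt (-Complex.I) v F z = ∑ i, v i * dz i F z := by
  conv_lhs => rw [vec_eq_sum_single v]
  simp only [wirt_vec_sum, wirt_vec_smul_holo, dz_eq_wirt]

theorem wirt_anti_eq_sum (v : CSpace m) (F : CSpace m → ℂ) (z : CSpace m) :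
    wirt Complex.I v F z = ∑ i, conj (v i) * dzbar i F z := by
  conv_lhs => rw [vec_eq_sum_single v]
  simp only [wirt_vec_sum, wirt_vec_smul_anti, dzbar_eq_wirt]

theorem ContDiffAt.wirt {k n : WithTop ℕ∞} (hF : ContDiffAt ℝ n F z) (hk : k + 1 ≤ n) :
    ContDiffAt ℝ k (wirt c v F) z := by
  have h := hF.fderiv_right hk
  unfold _root_.wirt
  fun_prop

theorem wirt_wirt (hF : ContDiffAt ℝ 2 F z) :
    wirt c v (wirt c' w F) z =
      (fderiv ℝ (fderiv ℝ F) z v w + c' * fderiv ℝ (fderiv ℝ F) z v (Complex.I • w)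
        + c * (fderiv ℝ (fderiv ℝ F) z (Complex.I • v) w
          + c' * fderiv ℝ (fderiv ℝ F) z (Complex.I • v) (Complex.I • w))) / 4 := by
  have h1 : DifferentiableAt ℝ (fderiv ℝ F) z :=
    (hF.fderiv_right (m := 1) (by norm_num)).differentiableAt (by norm_num)
  have h3 : ∀ x, DifferentiableAt ℝ (fun y => fderiv ℝ F y x) z := fun x => by fun_prop
  have h4 : ∀ x x', fderiv ℝ (fun y => fderiv ℝ F y x) z x' = fderiv ℝ (fderiv ℝ F) z x' x := by
    intro x x'
    rw [fderiv_clm_apply h1 (differentiableAt_const x)]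
    simp
  have h2 : wirt c' w F = fun y => (1 / 2 : ℂ) * (fderiv ℝ F y w)
      + (c' / 2) * (fderiv ℝ F y (Complex.I • w)) := by
    funext y; simp only [wirt]; ring
  rw [h2, wirt_add ((h3 _).const_mul _) ((h3 _).const_mul _), wirt_const_mul _ (h3 _),
    wirt_const_mul _ (h3 _)]
  simp only [wirt, h4]
  ring

theorem wirt_comm (hF : ContDiffAt ℝ 2 F z) :
    wirt c v (wirt c' w F) z = wirt c' w (wirt c v F) z := by
  have hs : IsSymmSndFDerivAt ℝ F z := hF.isSymmSndFDerivAt (by simp)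
  rw [wirt_wirt hF, wirt_wirt hF, hs.eq w v, hs.eq w (Complex.I • v), hs.eq (Complex.I • w) v,
    hs.eq (Complex.I • w) (Complex.I • v)]
  ring

end Wirtinger

/-! ### Differentiating matrix products, inverses and determinants -/

section MatrixCalculus

variable {m : ℕ}

/-- The entrywise derivative `wirt c v` of a matrix valued function. -/
def wirtM (c : ℂ) (v : CSpace m) (A : CSpace m → Matrix (Fin m) (Fin m) ℂ) (z : CSpace m) :
    Matrix (Fin m) (Fin m) ℂ :=
  Matrix.of fun i j => wirt c v (fun y => A y i j) z

variable {c c' : ℂ} {v w : CSpace m} {z : CSpace m} {A B : CSpace m → Matrix (Fin m) (Fin m) ℂ}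
  {k : WithTop ℕ∞}

theorem wirtM_congr (h : A =ᶠ[𝓝 z] B) : wirtM c v A z = wirtM c v B z := by
  ext i j
  exact wirt_congr (h.fun_comp fun M => M i j)

theorem wirtM_mul (hA : ∀ i j, DifferentiableAt ℝ (fun y => A y i j) z)
    (hB : ∀ i j, DifferentiableAt ℝ (fun y => B y i j) z) :
    wirtM c v (fun y => A y * B y) z = wirtM c v A z * B z + A z * wirtM c v B z := by
  ext i j
  simp only [wirtM, Matrix.mul_apply, Matrix.of_apply, Matrix.add_apply]
  rw [wirt_sum _ fun l _ => (hA i l).fun_mul (hB l j), ← Finset.sum_add_distrib]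
  exact Finset.sum_congr rfl fun l _ => wirt_mul (hA i l) (hB l j)

theorem wirtM_add (hA : ∀ i j, DifferentiableAt ℝ (fun y => A y i j) z)
    (hB : ∀ i j, DifferentiableAt ℝ (fun y => B y i j) z) :
    wirtM c v (fun y => A y + B y) z = wirtM c v A z + wirtM c v B z := by
  ext i j
  exact wirt_add (hA i j) (hB i j)

theorem wirtM_neg : wirtM c v (fun y => -A y) z = -wirtM c v A z := by
  ext i j
  exact wirt_neg

theorem wirtM_const (X : Matrix (Fin m) (Fin m) ℂ) : wirtM c v (fun _ => X) z = 0 := by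
  ext i j
  exact wirt_const _

theorem wirtM_const_mul_mul_const (X Y : Matrix (Fin m) (Fin m) ℂ)
    (hA : ∀ i j, DifferentiableAt ℝ (fun y => A y i j) z) :
    wirtM c v (fun y => X * A y * Y) z = X * wirtM c v A z * Y := by
  have h1 : ∀ i j, DifferentiableAt ℝ (fun y => (X * A y) i j) z := by
    intro i j
    simp only [Matrix.mul_apply]
    fun_prop
  rw [wirtM_mul (A := fun y => X * A y) (B := fun _ => Y) h1 (by fun_prop),
    wirtM_mul (A := fun _ => X) (by fun_prop) hA, wirtM_const, wirtM_const]
  simp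

theorem wirt_trace (hA : ∀ i j, DifferentiableAt ℝ (fun y => A y i j) z) :
    wirt c v (fun y => (A y).trace) z = (wirtM c v A z).trace := by
  simp only [Matrix.trace, Matrix.diag, wirtM, Matrix.of_apply]
  exact wirt_sum _ fun l _ => hA l l

theorem ContDiffAt.matrix_mul (hA : ∀ i j, ContDiffAt ℝ k (fun y => A y i j) z)
    (hB : ∀ i j, ContDiffAt ℝ k (fun y => B y i j) z) (i j : Fin m) :
    ContDiffAt ℝ k (fun y => (A y * B y) i j) z := by
  simp only [Matrix.mul_apply]
  fun_prop

theorem ContDiffAt.matrix_det (hA : ∀ i j, ContDiffAt ℝ k (fun y => A y i j) z) :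
    ContDiffAt ℝ k (fun y => (A y).det) z := by
  simp only [Matrix.det_apply']
  refine ContDiffAt.sum fun σ _ => contDiffAt_const.mul (contDiffAt_prod fun i _ => hA _ _)

theorem ContDiffAt.matrix_trace (hA : ∀ i j, ContDiffAt ℝ k (fun y => A y i j) z) :
    ContDiffAt ℝ k (fun y => (A y).trace) z := by
  simp only [Matrix.trace, Matrix.diag]
  fun_prop

theorem ContDiffAt.matrix_inv (hA : ∀ i j, ContDiffAt ℝ k (fun y => A y i j) z)
    (h0 : (A z).det ≠ 0) (i j : Fin m) :
    ContDiffAt ℝ k (fun y => (A y)⁻¹ i j) z := by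
  simp only [Matrix.inv_def, Ring.inverse_eq_inv', Matrix.smul_apply, smul_eq_mul,
    Matrix.adjugate_apply]
  refine ((ContDiffAt.matrix_det hA).inv h0).mul (ContDiffAt.matrix_det fun a b => ?_)
  by_cases h : a = j
  · subst h
    simp only [Matrix.updateRow_self]
    exact contDiffAt_const
  · simp only [Matrix.updateRow_ne h]
    exact hA a b

theorem ContDiffAt.wirtM {n : WithTop ℕ∞} (hA : ∀ i j, ContDiffAt ℝ n (fun y => A y i j) z)
    (hk : k + 1 ≤ n) (i j : Fin m) : ContDiffAt ℝ k (fun y => wirtM c v A y i j) z :=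
  (hA i j).wirt hk

theorem wirtM_inv (hA : ∀ i j, ContDiffAt ℝ 1 (fun y => A y i j) z) (h0 : (A z).det ≠ 0) :
    wirtM c v (fun y => (A y)⁻¹) z = -((A z)⁻¹ * wirtM c v A z * (A z)⁻¹) := by
  have hd : ∀ i j, DifferentiableAt ℝ (fun y => A y i j) z := fun i j =>
    (hA i j).differentiableAt (by norm_num)
  have hdi : ∀ i j, DifferentiableAt ℝ (fun y => (A y)⁻¹ i j) z := fun i j =>
    (ContDiffAt.matrix_inv hA h0 i j).differentiableAt (by norm_num)
  have hu : IsUnit (A z).det := isUnit_iff_ne_zero.2 h0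
  have h1 : wirtM c v (fun y => A y * (A y)⁻¹) z = 0 := by
    rw [← wirtM_const (c := c) (v := v) (z := z) 1]
    apply wirtM_congr
    filter_upwards [(ContDiffAt.matrix_det hA).continuousAt.eventually_ne h0] with y hy
      using Matrix.mul_nonsing_inv _ (isUnit_iff_ne_zero.2 hy)
  rw [wirtM_mul hd hdi] at h1
  have h2 : A z * wirtM c v (fun y => (A y)⁻¹) z = -(wirtM c v A z * (A z)⁻¹) :=
    eq_neg_of_add_eq_zero_right h1
  calc wirtM c v (fun y => (A y)⁻¹) z
      = (A z)⁻¹ * (A z * wirtM c v (fun y => (A y)⁻¹) z) := by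
        rw [← Matrix.mul_assoc, Matrix.nonsing_inv_mul _ hu, Matrix.one_mul]
    _ = _ := by rw [h2, Matrix.mul_neg, Matrix.mul_assoc]

/-- Jacobi's formula. -/
theorem wirt_det (hA : ∀ i j, DifferentiableAt ℝ (fun y => A y i j) z) (h0 : (A z).det ≠ 0) :
    wirt c v (fun y => (A y).det) z = (A z).det * ((A z)⁻¹ * wirtM c v A z).trace := by
  -- The product rule in the Leibniz formula differentiates one column at a time; Cramer's rule then
  -- turns the sum into a trace against the adjugate.
  have h1 : wirt c v (fun y => (A y).det) z =
      ∑ i, ((A z).updateCol i fun l => wirtM c v A z l i).det := by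
    simp only [Matrix.det_apply']
    have hp : ∀ σ : Equiv.Perm (Fin m), DifferentiableAt ℝ (fun y => ∏ i, A y (σ i) i) z :=
      fun σ => by fun_prop
    rw [wirt_sum _ fun σ _ => (hp σ).const_mul _, Finset.sum_comm]
    refine Finset.sum_congr rfl fun σ _ => ?_
    rw [wirt_const_mul _ (hp σ), wirt_prod _ fun i _ => hA _ _, Finset.mul_sum]
    refine Finset.sum_congr rfl fun i _ => ?_
    rw [← Finset.mul_prod_erase _ _ (Finset.mem_univ i), Matrix.updateCol_self]
    rw [mul_comm (∏ j ∈ Finset.univ.erase i, A z (σ j) j)]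
    congr 2
    refine Finset.prod_congr rfl fun j hj => ?_
    rw [Matrix.updateCol_ne (Finset.ne_of_mem_erase hj)]
  rw [h1, Matrix.inv_def, Ring.inverse_eq_inv', Matrix.smul_mul, Matrix.trace_smul, smul_eq_mul,
    mul_inv_cancel_left₀ h0]
  simp only [Matrix.trace, Matrix.diag]
  refine Finset.sum_congr rfl fun i _ => ?_
  rw [← Matrix.cramer_apply, Matrix.cramer_eq_adjugate_mulVec]
  rfl

end MatrixCalculus

/-! ### Inequalities and the algebraic identity for the eigenvalues -/

section Algebra

variable {m : ℕ}

/-- A refinement of the Cauchy-Schwarz inequality `|∑ xᵢ|² ≤ m ∑ |xᵢ|²` for vectors that are almost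
orthogonal to a positive vector `μ`. -/
theorem normSq_sum_le (hm : 2 ≤ m) (μ : Fin m → ℝ) (hμ : ∀ i, 0 < μ i) (x : Fin m → ℂ)
    (hE : 0 < (∑ i, μ i) ^ 2 - ∑ i, μ i ^ 2) :
    ‖∑ i, x i‖ ^ 2 ≤ ((m : ℝ) - 1) * ∑ i, ‖x i‖ ^ 2 +
      ‖∑ i, (μ i : ℂ) * x i‖ ^ 2 * (m / ((∑ i, μ i) ^ 2 - ∑ i, μ i ^ 2)) := by
  set S := ∑ i, μ i with hS
  set q := ∑ i, μ i ^ 2 with hq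
  set X := ∑ i, ‖x i‖ ^ 2 with hX
  set s := ‖∑ i, (μ i : ℂ) * x i‖ with hs
  set t := ‖∑ i, x i‖ with ht
  set n : ℝ := (m : ℝ) - 1 with hn
  have hm' : (2 : ℝ) ≤ m := by exact_mod_cast hm
  have hn1 : 1 ≤ n := by rw [hn]; linarith
  have hSpos : 0 < S := by
    have : Nonempty (Fin m) := ⟨⟨0, by omega⟩⟩
    exact Finset.sum_pos (fun i _ => hμ i) Finset.univ_nonempty
  have hX0 : 0 ≤ X := Finset.sum_nonneg fun i _ => by positivity
  have hq0 : 0 ≤ q := Finset.sum_nonneg fun i _ => by positivity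
  have hle : ∀ i, μ i ≤ S := fun i =>
    Finset.single_le_sum (fun j _ => (hμ j).le) (Finset.mem_univ i)
  -- Subtracting `∑ μ_i x_i` replaces the weights `S` by the smaller weights `S - μ_i`; this is the
  -- source of the gain.
  have h1 : S * t ≤ ∑ i, (S - μ i) * ‖x i‖ + s := by
    have e1 : (S : ℂ) * ∑ i, x i = ∑ i, ((S - μ i : ℝ) : ℂ) * x i + ∑ i, (μ i : ℂ) * x i := by
      rw [Finset.mul_sum, ← Finset.sum_add_distrib]
      refine Finset.sum_congr rfl fun i _ => ?_
      push_cast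
      ring
    calc S * t = ‖(S : ℂ) * ∑ i, x i‖ := by
          rw [norm_mul, Complex.norm_real, Real.norm_of_nonneg hSpos.le]
      _ ≤ ‖∑ i, ((S - μ i : ℝ) : ℂ) * x i‖ + s := by rw [e1]; exact norm_add_le _ _
      _ ≤ _ := by
        gcongr
        refine (norm_sum_le _ _).trans (Finset.sum_le_sum fun i _ => ?_)
        rw [norm_mul, Complex.norm_real, Real.norm_of_nonneg (sub_nonneg.2 (hle i))]
  set Y := ∑ i, (S - μ i) * ‖x i‖ with hY
  have hY0 : 0 ≤ Y := Finset.sum_nonneg fun i _ =>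
    mul_nonneg (sub_nonneg.2 (hle i)) (norm_nonneg _)
  -- `∑ (S - μ_i)² = (m - 2) S² + q`, which is `E` less than the allowed `(m - 1) S²`.
  have h2 : Y ^ 2 ≤ (n * S ^ 2 - (S ^ 2 - q)) * X := by
    have := Finset.sum_mul_sq_le_sq_mul_sq Finset.univ (fun i => S - μ i) fun i => ‖x i‖
    refine this.trans_eq ?_
    congr 1
    have : ∀ i, (S - μ i) ^ 2 = S ^ 2 - 2 * S * μ i + μ i ^ 2 := fun i => by ring
    simp only [this, Finset.sum_add_distrib, Finset.sum_sub_distrib, ← Finset.mul_sum,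
      Finset.sum_const, Finset.card_univ, Fintype.card_fin, nsmul_eq_mul, ← hS, ← hq]
    rw [hn]; ring
  set E := S ^ 2 - q with hEdef
  have hs0 : 0 ≤ s := norm_nonneg _
  have ht0 : 0 ≤ t := norm_nonneg _
  have h3 : (S * t) ^ 2 ≤ (Y + s) ^ 2 := by gcongr
  have hES : E ≤ S ^ 2 := by rw [hEdef]; linarith
  have hη : 0 < n * S ^ 2 := by positivity
  -- Young's inequality with weight `ε = E/(n S²)`, the largest simple choice for which `(1 + ε)(n
  -- S² - E) ≤ n S²`.
  have h4 : 2 * Y * s ≤ E / (n * S ^ 2) * Y ^ 2 + (n * S ^ 2) / E * s ^ 2 := by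
    have := sq_nonneg (E / (n * S ^ 2) * Y - s)
    have h5 : E / (n * S ^ 2) * Y ^ 2 + (n * S ^ 2) / E * s ^ 2 - 2 * Y * s =
      (n * S ^ 2) / E * (E / (n * S ^ 2) * Y - s) ^ 2 := by
      field_simp
      ring
    have : 0 ≤ (n * S ^ 2) / E * (E / (n * S ^ 2) * Y - s) ^ 2 := by positivity
    linarith
  have h6 : (1 + E / (n * S ^ 2)) * Y ^ 2 ≤ n * S ^ 2 * X := by
    have h7 : (1 + E / (n * S ^ 2)) * ((n * S ^ 2 - E) * X) ≤ n * S ^ 2 * X := by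
      have : n * S ^ 2 * X - (1 + E / (n * S ^ 2)) * ((n * S ^ 2 - E) * X) =
        E ^ 2 / (n * S ^ 2) * X := by
        field_simp
        ring
      have : 0 ≤ E ^ 2 / (n * S ^ 2) * X := by positivity
      linarith
    exact (mul_le_mul_of_nonneg_left h2 (by positivity)).trans h7
  have h8 : S ^ 2 * t ^ 2 ≤ n * S ^ 2 * X + S ^ 2 * (s ^ 2 * (m / E)) := by
    have e1 : (n * S ^ 2) / E * s ^ 2 + s ^ 2 ≤ S ^ 2 * (s ^ 2 * (m / E)) := by
      have : S ^ 2 * (s ^ 2 * (m / E)) - ((n * S ^ 2) / E * s ^ 2 + s ^ 2) =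
          s ^ 2 * (S ^ 2 - E) / E := by
        rw [hn]; field_simp; ring
      have : 0 ≤ s ^ 2 * (S ^ 2 - E) / E := by
        have := sub_nonneg.2 hES
        positivity
      linarith
    nlinarith
  have hS2 : 0 < S ^ 2 := by positivity
  refine le_of_mul_le_mul_left ?_ hS2
  linarith

/-- Adding the sum with `i` and `k` exchanged turns the weight into `(μ_i - μ_k)²/(μ_i μ_k)`. The
diagonal terms vanish, which is why holomorphic sectional curvatures need no sign. -/
theorem sum_mul_div_sub_one_nonneg (μ : Fin m → ℝ) (hμ : ∀ i, 0 < μ i) (r : Fin m → Fin m → ℝ)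
    (hsymm : ∀ i k, r i k = r k i) (hr : ∀ i k, i ≠ k → 0 ≤ r i k) :
    0 ≤ ∑ k, ∑ i, r k i * (μ i / μ k - 1) := by
  have h1 : ∑ k, ∑ i, r k i * (μ i / μ k - 1) = ∑ k, ∑ i, r k i * (μ k / μ i - 1) := by
    rw [Finset.sum_comm]
    exact Finset.sum_congr rfl fun k _ => Finset.sum_congr rfl fun i _ => by rw [hsymm]
  have h2 : 0 ≤ ∑ k, ∑ i, (r k i * (μ i / μ k - 1) + r k i * (μ k / μ i - 1)) := by
    refine Finset.sum_nonneg fun k _ => Finset.sum_nonneg fun i _ => ?_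
    by_cases h : k = i
    · subst h
      simp [div_self (hμ k).ne']
    · have e : r k i * (μ i / μ k - 1) + r k i * (μ k / μ i - 1) =
          r k i * ((μ i - μ k) ^ 2 / (μ i * μ k)) := by
        have := hμ i
        have := hμ k
        field_simp
        ring
      rw [e]
      have := hμ i
      have := hμ k
      have := hr k i h
      positivity
  simp only [Finset.sum_add_distrib] at h2
  linarith

/-- Here `g` and `w` stand for first derivatives of the metric and of `W`, `γ` and `θ` for diagonal
second derivatives, `U` for the second derivatives of the trace and `Q` for those of `log f`. The
fourth derivatives `θ` of the potential occur in both `hU` and `hQ`; the Kähler symmetry of `θ`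
matches them. The remaining third order terms complete to squares of `w - gμ`, the covariant
derivative of `W`. Keeping `g` makes normal coordinates unnecessary. -/
theorem sum_second_order_identity (μ : Fin m → ℝ) (hμ : ∀ i, 0 < μ i)
    (g w : Fin m → Fin m → Fin m → ℂ) (γ θ : Fin m → Fin m → ℂ) (U Q : Fin m → ℂ)
    (hg : ∀ k i j, g k i j = g i k j) (hw : ∀ k i j, w k i j = w i k j)
    (hθ : ∀ k i, θ k i = θ i k)
    (hU : ∀ k, U k = (∑ i, ((∑ p, g k i p * conj (g k i p)) - γ k i) * μ i)
      + (∑ i, ∑ p, (conj (g k p i) * g k p i * μ i - conj (g k p i) * w k p i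
        - g k p i * conj (w k p i))) + ∑ i, θ k i)
    (hQ : ∀ p, (∑ k, θ p k / μ k) - (∑ k, ∑ i, w p k i * conj (w p k i) / (μ k * μ i)) =
      Q p - ∑ k, ((∑ i, g p k i * conj (g p k i)) - γ p k)) :
    ∑ k, U k / μ k = (∑ k, ∑ i, ((∑ p, g k i p * conj (g k i p)) - γ k i) * (μ i / μ k - 1))
      + ∑ p, Q p + ∑ p, ∑ k, ∑ i,
        (w p k i - g p k i * μ i) * conj (w p k i - g p k i * μ i) / (μ k * μ i) := by
  have hμ' : ∀ i, (μ i : ℂ) ≠ 0 := fun i => by exact_mod_cast (hμ i).ne'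
  have e1 : ∑ k, U k / μ k =
      (∑ k, ∑ i, ((∑ p, g k i p * conj (g k i p)) - γ k i) * (μ i / μ k))
      + (∑ k, ∑ p, ∑ i, (conj (g k p i) * g k p i * μ i - conj (g k p i) * w k p i
        - g k p i * conj (w k p i)) / μ k) + ∑ k, ∑ i, θ k i / μ k := by
    rw [← Finset.sum_add_distrib, ← Finset.sum_add_distrib]
    refine Finset.sum_congr rfl fun k _ => ?_
    rw [hU, add_div, add_div, Finset.sum_div, Finset.sum_div, Finset.sum_div]
    congr 2
    · exact Finset.sum_congr rfl fun i _ => by ring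
    · rw [Finset.sum_comm]
      simp only [Finset.sum_div]
  have e2 : (∑ k, ∑ p, ∑ i, (conj (g k p i) * g k p i * μ i - conj (g k p i) * w k p i
        - g k p i * conj (w k p i)) / μ k) =
      ∑ p, ∑ k, ∑ i, (conj (g p k i) * g p k i * μ i - conj (g p k i) * w p k i
        - g p k i * conj (w p k i)) / μ k := by
    rw [Finset.sum_comm]
    refine Finset.sum_congr rfl fun p _ => Finset.sum_congr rfl fun k _ =>
      Finset.sum_congr rfl fun i _ => ?_
    rw [hg k p i, hw k p i]
  have e3 : ∑ k, ∑ i, θ k i / μ k = ∑ p, ∑ k, θ p k / μ k := by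
    rw [Finset.sum_comm]
    exact Finset.sum_congr rfl fun p _ => Finset.sum_congr rfl fun k _ => by rw [hθ]
  have e4 : ∑ p, ∑ k, θ p k / μ k = ∑ p, (∑ k, ∑ i, w p k i * conj (w p k i) / (μ k * μ i)) +
      ∑ p, Q p - ∑ p, ∑ k, ((∑ i, g p k i * conj (g p k i)) - γ p k) := by
    rw [← Finset.sum_add_distrib, ← Finset.sum_sub_distrib]
    exact Finset.sum_congr rfl fun p _ => by linear_combination hQ p
  have e5 : ∑ p, ∑ k, ∑ i,
        (w p k i - g p k i * μ i) * conj (w p k i - g p k i * μ i) / (μ k * μ i) =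
      (∑ p, ∑ k, ∑ i, (conj (g p k i) * g p k i * μ i - conj (g p k i) * w p k i
        - g p k i * conj (w p k i)) / μ k) +
      ∑ p, (∑ k, ∑ i, w p k i * conj (w p k i) / (μ k * μ i)) := by
    simp only [← Finset.sum_add_distrib]
    refine Finset.sum_congr rfl fun p _ => Finset.sum_congr rfl fun k _ =>
      Finset.sum_congr rfl fun i _ => ?_
    simp only [map_sub, map_mul, Complex.conj_ofReal]
    have := hμ' i
    have := hμ' k
    field_simp
    ring
  have e6 : (∑ k, ∑ i, ((∑ p, g k i p * conj (g k i p)) - γ k i) * (μ i / μ k - 1 : ℂ)) =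
      (∑ k, ∑ i, ((∑ p, g k i p * conj (g k i p)) - γ k i) * (μ i / μ k)) -
      ∑ p, ∑ k, ((∑ i, g p k i * conj (g p k i)) - γ p k) := by
    simp only [← Finset.sum_sub_distrib]
    refine Finset.sum_congr rfl fun p _ => Finset.sum_congr rfl fun k _ => ?_
    ring
  rw [e1, e2, e3, e4, e5, e6]
  ring

end Algebra

/-! ### Second derivatives of the trace and of the logarithm of the determinant -/

section SecondOrder

variable {m : ℕ} {c c' : ℂ} {v w z : CSpace m} {G W X : CSpace m → Matrix (Fin m) (Fin m) ℂ}

theorem wirt_trace_inv_mul (hG : ∀ i j, ContDiffAt ℝ 1 (fun y => G y i j) z)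
    (hX : ∀ i j, ContDiffAt ℝ 1 (fun y => X y i j) z) (h0 : (G z).det ≠ 0) :
    wirt c v (fun y => ((G y)⁻¹ * X y).trace) z =
      (-((G z)⁻¹ * wirtM c v G z * (G z)⁻¹) * X z + (G z)⁻¹ * wirtM c v X z).trace := by
  have hi := ContDiffAt.matrix_inv hG h0
  rw [wirt_trace fun i j =>
      (ContDiffAt.matrix_mul hi hX i j).differentiableAt (by norm_num),
    wirtM_mul (A := fun y => (G y)⁻¹) (fun i j => (hi i j).differentiableAt (by norm_num))
      (fun i j => (hX i j).differentiableAt (by norm_num)), wirtM_inv hG h0]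

/-- Only the value of `G` is normalized; its first derivatives survive and later form part of the
curvature. -/
theorem wirt_wirt_trace_inv_mul (hG : ∀ i j, ContDiffAt ℝ 2 (fun y => G y i j) z)
    (hW : ∀ i j, ContDiffAt ℝ 2 (fun y => W y i j) z) (h1 : G z = 1) :
    wirt c v (wirt c' w fun y => ((G y)⁻¹ * W y).trace) z =
      (wirtM c v G z * wirtM c' w G z * W z - wirtM c v (wirtM c' w G) z * W z
        + wirtM c' w G z * wirtM c v G z * W z - wirtM c' w G z * wirtM c v W z
        - wirtM c v G z * wirtM c' w W z + wirtM c v (wirtM c' w W) z).trace := by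
  have h0 : (G z).det ≠ 0 := by simp [h1]
  have hG1 : ∀ i j, ContDiffAt ℝ 1 (fun y => G y i j) z := fun i j => (hG i j).of_le (by norm_num)
  have hW1 : ∀ i j, ContDiffAt ℝ 1 (fun y => W y i j) z := fun i j => (hW i j).of_le (by norm_num)
  have hGc : ∀ i j, ContDiffAt ℝ 1 (fun y => wirtM c' w G y i j) z :=
    ContDiffAt.wirtM hG (by norm_num)
  have hWc : ∀ i j, ContDiffAt ℝ 1 (fun y => wirtM c' w W y i j) z :=
    ContDiffAt.wirtM hW (by norm_num)
  have hP := ContDiffAt.matrix_inv hG1 h0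
  have hPW := ContDiffAt.matrix_mul hP hW1
  have hGPW := ContDiffAt.matrix_mul hGc hPW
  have hX : ∀ i j, ContDiffAt ℝ 1
      (fun y => (wirtM c' w W y + -(wirtM c' w G y * ((G y)⁻¹ * W y))) i j) z := fun i j =>
    (hWc i j).add (hGPW i j).neg
  -- Near `z` the first derivative is again of the form `tr(G⁻¹X)`, so the first order formula can
  -- be applied a second time.
  have e1 : wirt c' w (fun y => ((G y)⁻¹ * W y).trace) =ᶠ[𝓝 z] fun y =>
      ((G y)⁻¹ * (wirtM c' w W y + -(wirtM c' w G y * ((G y)⁻¹ * W y)))).trace := by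
    have eG : ∀ᶠ y in 𝓝 z, ∀ i j, ContDiffAt ℝ 1 (fun y => G y i j) y :=
      eventually_all.2 fun i => eventually_all.2 fun j => (hG1 i j).eventually (by simp)
    have eW : ∀ᶠ y in 𝓝 z, ∀ i j, ContDiffAt ℝ 1 (fun y => W y i j) y :=
      eventually_all.2 fun i => eventually_all.2 fun j => (hW1 i j).eventually (by simp)
    filter_upwards [eG, eW, (ContDiffAt.matrix_det hG1).continuousAt.eventually_ne h0]
      with y h1 h2 h3
    rw [wirt_trace_inv_mul h1 h2 h3]
    congr 1
    simp only [Matrix.mul_add, Matrix.mul_neg, Matrix.neg_mul, Matrix.mul_assoc]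
    abel
  have d : ∀ {A : CSpace m → Matrix (Fin m) (Fin m) ℂ},
      (∀ i j, ContDiffAt ℝ 1 (fun y => A y i j) z) →
      ∀ i j, DifferentiableAt ℝ (fun y => A y i j) z := fun h i j =>
    (h i j).differentiableAt (by norm_num)
  rw [wirt_congr e1, wirt_trace_inv_mul hG1 hX h0,
    wirtM_add (B := fun y => -(wirtM c' w G y * ((G y)⁻¹ * W y))) (d hWc)
      (fun i j => (d hGPW i j).neg), wirtM_neg, wirtM_mul (d hGc) (d hPW),
    wirtM_mul (A := fun y => (G y)⁻¹) (d hP) (d hW1), wirtM_inv hG1 h0, h1]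
  congr 1
  simp only [inv_one, Matrix.one_mul, Matrix.mul_one, Matrix.mul_add, Matrix.mul_neg,
    Matrix.neg_mul, Matrix.mul_assoc, neg_add, neg_neg]
  abel

variable {n : ℕ} {H : CSpace m → ℂ}

/-- This is the derivative of `log det W = n log H + log det G`, obtained from Jacobi's formula
without choosing a logarithm. -/
theorem trace_inv_mul_wirtM_of_det_eq (hG : ∀ i j, ContDiffAt ℝ 1 (fun y => G y i j) z)
    (hW : ∀ i j, ContDiffAt ℝ 1 (fun y => W y i j) z) (hH : ContDiffAt ℝ 1 H z)
    (h0 : (G z).det ≠ 0) (hW0 : (W z).det ≠ 0) (hH0 : H z ≠ 0)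
    (hdet : ∀ᶠ y in 𝓝 z, (W y).det = H y ^ n * (G y).det) :
    ((W z)⁻¹ * wirtM c v W z).trace =
      n * (wirt c v H z * (H z)⁻¹) + ((G z)⁻¹ * wirtM c v G z).trace := by
  have dG : ∀ i j, DifferentiableAt ℝ (fun y => G y i j) z := fun i j =>
    (hG i j).differentiableAt (by norm_num)
  have dH : DifferentiableAt ℝ H z := hH.differentiableAt (by norm_num)
  have e := wirt_congr (c := c) (v := v) hdet
  rw [wirt_det (fun i j => (hW i j).differentiableAt (by norm_num)) hW0,
    wirt_mul (F := fun y => H y ^ n) (dH.pow n)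
      ((ContDiffAt.matrix_det hG).differentiableAt (by norm_num)),
    wirt_pow n dH, wirt_det dG h0, hdet.self_of_nhds] at e
  have hp : H z ^ n * (G z).det ≠ 0 := mul_ne_zero (pow_ne_zero _ hH0) h0
  apply mul_left_cancel₀ hp
  rw [e]
  rcases n with _ | n
  · simp
  · simp only [Nat.add_sub_cancel, pow_succ]
    field_simp

/-- The logarithmic first order identity holds in a neighbourhood, so it may be differentiated once
more. -/
theorem trace_wirtM_wirtM_of_det_eq (hG : ∀ i j, ContDiffAt ℝ 2 (fun y => G y i j) z)
    (hW : ∀ i j, ContDiffAt ℝ 2 (fun y => W y i j) z) (hH : ContDiffAt ℝ 2 H z)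
    (h0 : (G z).det ≠ 0) (hW0 : (W z).det ≠ 0) (hH0 : H z ≠ 0)
    (hdet : ∀ᶠ y in 𝓝 z, (W y).det = H y ^ n * (G y).det) :
    (-((W z)⁻¹ * wirtM c v W z * (W z)⁻¹) * wirtM c' w W z
        + (W z)⁻¹ * wirtM c v (wirtM c' w W) z).trace =
      n * (wirt c v (wirt c' w H) z * (H z)⁻¹ - wirt c v H z * wirt c' w H z / H z ^ 2)
      + (-((G z)⁻¹ * wirtM c v G z * (G z)⁻¹) * wirtM c' w G z
        + (G z)⁻¹ * wirtM c v (wirtM c' w G) z).trace := by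
  have hG1 : ∀ i j, ContDiffAt ℝ 1 (fun y => G y i j) z := fun i j => (hG i j).of_le (by norm_num)
  have hW1 : ∀ i j, ContDiffAt ℝ 1 (fun y => W y i j) z := fun i j => (hW i j).of_le (by norm_num)
  have hH1 : ContDiffAt ℝ 1 H z := hH.of_le (by norm_num)
  have hGc : ∀ i j, ContDiffAt ℝ 1 (fun y => wirtM c' w G y i j) z :=
    ContDiffAt.wirtM hG (by norm_num)
  have hWc : ∀ i j, ContDiffAt ℝ 1 (fun y => wirtM c' w W y i j) z :=
    ContDiffAt.wirtM hW (by norm_num)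
  have hHc : ContDiffAt ℝ 1 (wirt c' w H) z := hH.wirt (by norm_num)
  have e : (fun y => ((W y)⁻¹ * wirtM c' w W y).trace) =ᶠ[𝓝 z] fun y =>
      n * (wirt c' w H y * (H y)⁻¹) + ((G y)⁻¹ * wirtM c' w G y).trace := by
    have eG : ∀ᶠ y in 𝓝 z, ∀ i j, ContDiffAt ℝ 1 (fun y => G y i j) y :=
      eventually_all.2 fun i => eventually_all.2 fun j => (hG1 i j).eventually (by simp)
    have eW : ∀ᶠ y in 𝓝 z, ∀ i j, ContDiffAt ℝ 1 (fun y => W y i j) y :=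
      eventually_all.2 fun i => eventually_all.2 fun j => (hW1 i j).eventually (by simp)
    filter_upwards [eG, eW, hH1.eventually (by simp),
      (ContDiffAt.matrix_det hG1).continuousAt.eventually_ne h0,
      (ContDiffAt.matrix_det hW1).continuousAt.eventually_ne hW0,
      hH1.continuousAt.eventually_ne hH0, hdet.eventually_nhds] with y h1 h2 h3 h4 h5 h6 h7
    exact trace_inv_mul_wirtM_of_det_eq h1 h2 h3 h4 h5 h6 h7
  have dH : DifferentiableAt ℝ H z := hH1.differentiableAt (by norm_num)
  have dHc : DifferentiableAt ℝ (wirt c' w H) z := hHc.differentiableAt (by norm_num)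
  have dHi : DifferentiableAt ℝ (fun y => (H y)⁻¹) z := dH.inv hH0
  have dq : DifferentiableAt ℝ (fun y => wirt c' w H y * (H y)⁻¹) z := dHc.mul dHi
  have dt : DifferentiableAt ℝ (fun y => ((G y)⁻¹ * wirtM c' w G y).trace) z :=
    (ContDiffAt.matrix_trace (ContDiffAt.matrix_mul (ContDiffAt.matrix_inv hG1 h0)
      hGc)).differentiableAt (by norm_num)
  rw [← wirt_trace_inv_mul hW1 hWc hW0, wirt_congr e, wirt_add (dq.const_mul _) dt,
    wirt_const_mul _ dq, wirt_trace_inv_mul hG1 hGc h0, wirt_mul dHc dHi, wirt_inv dH hH0]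
  congr 2
  ring

end SecondOrder

/-! ### The differential inequality for the trace -/

section PointwiseInequality

variable {m : ℕ}

theorem wirtM_conjTranspose {v z : CSpace m} {G : CSpace m → Matrix (Fin m) (Fin m) ℂ}
    (hG : ∀ i j, DifferentiableAt ℝ (fun y => G y i j) z)
    (hH : ∀ᶠ y in 𝓝 z, (G y).IsHermitian) (i j : Fin m) :
    wirtM Complex.I v G z i j = conj (wirtM (-Complex.I) v G z j i) := by
  simp only [wirtM, Matrix.of_apply]
  rw [conj_wirt (hG j i)]
  simp only [map_neg, Complex.conj_I, neg_neg]
  apply wirt_congr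
  filter_upwards [hH] with y hy
  exact (hy.apply i j).symm

/-- If `∂_k G_{i j̄} = ∂_i G_{k j̄}` then `∂_k ∂_k̄ G_{i ī} = ∂_i ∂_ī G_{k k̄}`. -/
theorem wirtM_wirtM_diag_symm {v : Fin m → CSpace m} {z : CSpace m}
    {G : CSpace m → Matrix (Fin m) (Fin m) ℂ}
    (hG : ∀ i j, ContDiffAt ℝ 2 (fun y => G y i j) z)
    (hH : ∀ᶠ y in 𝓝 z, (G y).IsHermitian)
    (hK : ∀ᶠ y in 𝓝 z, ∀ i j k, wirtM (-Complex.I) (v k) G y i j = wirtM (-Complex.I) (v i) G y k j)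
    (k i : Fin m) :
    wirtM (-Complex.I) (v k) (wirtM Complex.I (v k) G) z i i =
      wirtM (-Complex.I) (v i) (wirtM Complex.I (v i) G) z k k := by
  have dG : ∀ᶠ y in 𝓝 z, ∀ i j, DifferentiableAt ℝ (fun y => G y i j) y :=
    eventually_all.2 fun i => eventually_all.2 fun j => by
      filter_upwards [(hG i j).eventually (by simp)] with y hy
      exact hy.differentiableAt (by norm_num)
  calc wirtM (-Complex.I) (v k) (wirtM Complex.I (v k) G) z i i
      -- Closedness is used twice: here in conjugated form, and once more after the two derivatives
      -- have been exchanged.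
      = wirt (-Complex.I) (v k) (wirt Complex.I (v i) fun y => G y i k) z := by
        apply wirt_congr
        filter_upwards [dG, hH.eventually_nhds, hK] with y h1 h2 h3
        rw [wirtM_conjTranspose h1 h2, h3, ← wirtM_conjTranspose h1 h2]
        rfl
    _ = wirt Complex.I (v i) (wirt (-Complex.I) (v k) fun y => G y i k) z := wirt_comm (hG i k)
    _ = wirt Complex.I (v i) (wirt (-Complex.I) (v i) fun y => G y k k) z := by
        apply wirt_congr
        filter_upwards [hK] with y h3
        exact h3 i k k
    _ = _ := wirt_comm (hG k k)

/-- The differential inequality for the trace `u = tr(G⁻¹W)` at a point where `G = 1` and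
`W` is diagonal. -/
theorem sum_wirt_wirt_trace_ge (hm : 2 ≤ m) (v : Fin m → CSpace m) (z : CSpace m)
    (G W : CSpace m → Matrix (Fin m) (Fin m) ℂ) (H : CSpace m → ℝ) (μ : Fin m → ℝ)
    (hμ : ∀ i, 0 < μ i)
    (hG : ∀ i j, ContDiffAt ℝ 2 (fun y => G y i j) z)
    (hW : ∀ i j, ContDiffAt ℝ 2 (fun y => W y i j) z)
    (hH : ContDiffAt ℝ 2 (fun y => (H y : ℂ)) z) (hH0 : 0 < H z)
    (hGH : ∀ᶠ y in 𝓝 z, (G y).IsHermitian) (hWH : ∀ᶠ y in 𝓝 z, (W y).IsHermitian)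
    (hGK : ∀ᶠ y in 𝓝 z, ∀ i j k,
      wirtM (-Complex.I) (v k) G y i j = wirtM (-Complex.I) (v i) G y k j)
    (hWK : ∀ᶠ y in 𝓝 z, ∀ i j k,
      wirtM (-Complex.I) (v k) W y i j = wirtM (-Complex.I) (v i) W y k j)
    (hdet : ∀ᶠ y in 𝓝 z, (W y).det = (H y : ℂ) ^ (m - 1) * (G y).det)
    (hG1 : G z = 1) (hW1 : W z = Matrix.diagonal fun i => (μ i : ℂ))
    (hR : ∀ a b, a ≠ b → 0 ≤ ((wirtM (-Complex.I) (v b) G z * wirtM Complex.I (v b) G z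
      - wirtM (-Complex.I) (v b) (wirtM Complex.I (v b) G) z) a a).re)
    (hE : 0 < (∑ i, μ i) ^ 2 - ∑ i, μ i ^ 2) :
    ((m : ℝ) - 1) / H z *
        ∑ i, (wirt (-Complex.I) (v i) (wirt Complex.I (v i) fun y => (H y : ℂ)) z).re
      - m / (((m : ℝ) - 1) * ((∑ i, μ i) ^ 2 - ∑ i, μ i ^ 2)) *
        ∑ i, ‖wirt (-Complex.I) (v i) (fun y => ((G y)⁻¹ * W y).trace) z‖ ^ 2
    ≤ ∑ k, (wirt (-Complex.I) (v k)
        (wirt Complex.I (v k) fun y => ((G y)⁻¹ * W y).trace) z).re / μ k := by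
  set E := (∑ i, μ i) ^ 2 - ∑ i, μ i ^ 2 with hEdef
  have hμ' : ∀ i, (μ i : ℂ) ≠ 0 := fun i => by exact_mod_cast (hμ i).ne'
  have hd0 : (G z).det ≠ 0 := by simp [hG1]
  have hdW0 : (W z).det ≠ 0 := by
    rw [hW1, Matrix.det_diagonal]
    exact Finset.prod_ne_zero_iff.2 fun i _ => hμ' i
  have hHc0 : ((H z : ℝ) : ℂ) ≠ 0 := by exact_mod_cast hH0.ne'
  have hGc1 : ∀ i j, ContDiffAt ℝ 1 (fun y => G y i j) z := fun i j => (hG i j).of_le (by norm_num)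
  have hWc1 : ∀ i j, ContDiffAt ℝ 1 (fun y => W y i j) z := fun i j => (hW i j).of_le (by norm_num)
  have dG : ∀ i j, DifferentiableAt ℝ (fun y => G y i j) z := fun i j =>
    (hG i j).differentiableAt (by norm_num)
  have dW : ∀ i j, DifferentiableAt ℝ (fun y => W y i j) z := fun i j =>
    (hW i j).differentiableAt (by norm_num)
  have dH : DifferentiableAt ℝ (fun y => (H y : ℂ)) z := hH.differentiableAt (by norm_num)
  have hm1 : ((m - 1 : ℕ) : ℂ) = ((m - 1 : ℝ) : ℂ) := by
    rw [Nat.cast_sub (by omega)]; push_cast; ring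
  have hWinv : (W z)⁻¹ = Matrix.diagonal fun i => ((μ i : ℂ))⁻¹ := by
    rw [hW1]
    apply Matrix.inv_eq_right_inv
    rw [Matrix.diagonal_mul_diagonal]
    simp [hμ']
  set n : ℝ := (m : ℝ) - 1 with hn
  have hm' : (2 : ℝ) ≤ m := by exact_mod_cast hm
  have hn0 : 0 < n := by rw [hn]; linarith
  set u : CSpace m → ℂ := fun y => ((G y)⁻¹ * W y).trace with hu
  set g : Fin m → Fin m → Fin m → ℂ := fun k i j => wirtM (-Complex.I) (v k) G z i j with hg
  set w : Fin m → Fin m → Fin m → ℂ := fun k i j => wirtM (-Complex.I) (v k) W z i j with hw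
  set γ : Fin m → Fin m → ℂ := fun k i =>
    wirtM (-Complex.I) (v k) (wirtM Complex.I (v k) G) z i i with hγ
  set θ : Fin m → Fin m → ℂ := fun k i =>
    wirtM (-Complex.I) (v k) (wirtM Complex.I (v k) W) z i i with hθ
  set Hp : Fin m → ℂ := fun k => wirt (-Complex.I) (v k) (fun y => (H y : ℂ)) z with hHp
  set Hpp : Fin m → ℂ := fun k =>
    wirt (-Complex.I) (v k) (wirt Complex.I (v k) fun y => (H y : ℂ)) z with hHpp
  have hgbar : ∀ k i j, wirtM Complex.I (v k) G z i j = conj (g k j i) := fun k i j =>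
    wirtM_conjTranspose dG hGH i j
  have hwbar : ∀ k i j, wirtM Complex.I (v k) W z i j = conj (w k j i) := fun k i j =>
    wirtM_conjTranspose dW hWH i j
  have hHbar : ∀ k, wirt Complex.I (v k) (fun y => (H y : ℂ)) z = conj (Hp k) := fun k => by
    rw [hHp, conj_wirt dH]
    simp
  -- `Q p` is the second derivative of `log f = n log H` in the direction `v p`.
  set Q : Fin m → ℂ := fun p => n * (Hpp p / H z - Hp p * conj (Hp p) / H z ^ 2) with hQ
  have hgs : ∀ k i j, g k i j = g i k j := fun k i j => hGK.self_of_nhds i j k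
  have hws : ∀ k i j, w k i j = w i k j := fun k i j => hWK.self_of_nhds i j k
  have key := sum_second_order_identity μ hμ g w γ θ
    (fun k => wirt (-Complex.I) (v k) (wirt Complex.I (v k) u) z) Q hgs hws
    (fun k i => wirtM_wirtM_diag_symm hW hWH hWK k i)
    (fun k => by
      rw [wirt_wirt_trace_inv_mul hG hW hG1, hW1]
      simp only [Matrix.trace, Matrix.diag, Matrix.add_apply, Matrix.sub_apply,
        Matrix.mul_diagonal]
      simp only [Matrix.mul_apply, hgbar, hwbar, Finset.sum_add_distrib, Finset.sum_sub_distrib,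
        sub_mul, Finset.sum_mul]
      rw [Finset.sum_comm (f := fun i p => wirtM (-Complex.I) (v k) G z i p * conj (w k i p))]
      ring)
    (fun p => by
      have h := trace_wirtM_wirtM_of_det_eq (c := -Complex.I) (c' := Complex.I) (v := v p)
        (w := v p) hG hW hH hd0 hdW0 hHc0 hdet
      rw [hWinv, hG1] at h
      simp only [inv_one, Matrix.one_mul, Matrix.mul_one, Matrix.neg_mul] at h
      obtain ⟨Z, hZ⟩ : ∃ Z, Z = (Matrix.diagonal fun i => ((μ i : ℂ))⁻¹) *
        wirtM (-Complex.I) (v p) W z * Matrix.diagonal fun i => ((μ i : ℂ))⁻¹ := ⟨_, rfl⟩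
      have hZe : ∀ k i, Z k i = (μ k : ℂ)⁻¹ * wirtM (-Complex.I) (v p) W z k i * (μ i : ℂ)⁻¹ :=
        fun k i => by rw [hZ, Matrix.mul_diagonal, Matrix.diagonal_mul]
      rw [← hZ] at h
      simp only [Matrix.trace, Matrix.diag, Matrix.add_apply, Matrix.neg_apply,
        Matrix.diagonal_mul] at h
      simp only [Matrix.mul_apply, hZe, hgbar, hwbar, hm1, hHbar,
        Finset.sum_add_distrib, Finset.sum_neg_distrib] at h
      have e1 : ∑ k, θ p k / μ k = ∑ k, (μ k : ℂ)⁻¹ * θ p k :=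
        Finset.sum_congr rfl fun k _ => by rw [div_eq_inv_mul]
      have e2 : ∑ k, ∑ i, w p k i * conj (w p k i) / (μ k * μ i) =
          ∑ k, ∑ i, (μ k : ℂ)⁻¹ * wirtM (-Complex.I) (v p) W z k i * (μ i : ℂ)⁻¹ *
            conj (w p k i) :=
        Finset.sum_congr rfl fun k _ => Finset.sum_congr rfl fun i _ => by
          have := hμ' i
          have := hμ' k
          simp only [hw]
          field_simp
      rw [e1, e2, Finset.sum_sub_distrib]
      simp only [hQ, div_eq_mul_inv] at h ⊢
      linear_combination h)
  have hgrad : ∀ p, wirt (-Complex.I) (v p) u z = ∑ k, (w p k k - g p k k * μ k) := fun p => by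
    rw [hu, wirt_trace_inv_mul hGc1 hWc1 hd0, hG1, hW1]
    simp only [inv_one, Matrix.one_mul, Matrix.mul_one, Matrix.neg_mul, Matrix.trace, Matrix.diag,
      Matrix.add_apply, Matrix.neg_apply, Matrix.mul_diagonal]
    exact Finset.sum_congr rfl fun k _ => by ring
  have hlog : ∀ p, (n : ℂ) * (Hp p * (H z : ℂ)⁻¹) = ∑ k, (w p k k - g p k k * μ k) / μ k := by
    intro p
    have h := trace_inv_mul_wirtM_of_det_eq (c := -Complex.I) (v := v p) hGc1 hWc1
      (hH.of_le (by norm_num)) hd0 hdW0 hHc0 hdet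
    rw [hWinv, hG1, hm1] at h
    simp only [inv_one, Matrix.one_mul, Matrix.trace, Matrix.diag, Matrix.diagonal_mul] at h
    rw [← sub_eq_iff_eq_add, ← Finset.sum_sub_distrib] at h
    rw [← h]
    refine Finset.sum_congr rfl fun k _ => ?_
    have := hμ' k
    simp only [hw, hg]
    field_simp
  -- With `x_k = (w_{pkk} - g_{pkk} μ_k)/μ_k`, the sum `∑ x_k` is the derivative of `log f` and `∑
  -- μ_k x_k` that of the trace. The refined Cauchy-Schwarz constant `n = m - 1` cancels the factor
  -- in `n|∂H|²/H²`.
  have hQre : ∀ p, n / H z * (Hpp p).re - ∑ k, ‖w p k k - g p k k * μ k‖ ^ 2 / (μ k * μ k)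
      - m / (n * E) * ‖wirt (-Complex.I) (v p) u z‖ ^ 2 ≤ (Q p).re := by
    intro p
    have h1 := normSq_sum_le hm μ hμ (fun k => (w p k k - g p k k * μ k) / μ k) hE
    rw [← hlog p] at h1
    have h2 : ∑ k, (μ k : ℂ) * ((w p k k - g p k k * μ k) / μ k) =
        wirt (-Complex.I) (v p) u z := by
      rw [hgrad p]
      exact Finset.sum_congr rfl fun k _ => mul_div_cancel₀ _ (hμ' k)
    rw [h2] at h1
    have h3 : ∑ k, ‖(w p k k - g p k k * μ k) / μ k‖ ^ 2 =
        ∑ k, ‖w p k k - g p k k * μ k‖ ^ 2 / (μ k * μ k) :=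
      Finset.sum_congr rfl fun k _ => by
        rw [norm_div, Complex.norm_real, Real.norm_of_nonneg (hμ k).le, div_pow, sq (μ k)]
    rw [h3] at h1
    have h4 : (Q p).re = n / H z * (Hpp p).re - n * (‖Hp p‖ ^ 2 / H z ^ 2) := by
      have e : Q p = ((n / H z : ℝ) : ℂ) * Hpp p - ((n * (‖Hp p‖ ^ 2 / H z ^ 2) : ℝ) : ℂ) := by
        simp only [hQ, Complex.mul_conj, Complex.normSq_eq_norm_sq]
        push_cast
        ring
      rw [e, Complex.sub_re, Complex.re_ofReal_mul, Complex.ofReal_re]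
    have h5 : ‖(n : ℂ) * (Hp p * (H z : ℂ)⁻¹)‖ ^ 2 = n * (n * (‖Hp p‖ ^ 2 / H z ^ 2)) := by
      rw [norm_mul, norm_mul, norm_inv, Complex.norm_real, Complex.norm_real,
        Real.norm_of_nonneg hn0.le, Real.norm_of_nonneg hH0.le]
      field_simp
    rw [h5, ← hn, ← hEdef] at h1
    have h6 : n * (n * (‖Hp p‖ ^ 2 / H z ^ 2)) ≤
        n * (∑ k, ‖w p k k - g p k k * μ k‖ ^ 2 / (μ k * μ k)
          + m / (n * E) * ‖wirt (-Complex.I) (v p) u z‖ ^ 2) := by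
      refine h1.trans_eq ?_
      rw [mul_add]
      congr 1
      field_simp
    have h7 := le_of_mul_le_mul_left h6 hn0
    rw [h4]
    linarith
  -- `hR` says that the coefficients, which are bisectional curvatures in the frame, are nonnegative
  -- off the diagonal.
  have hRre : 0 ≤ (∑ k, ∑ i,
      ((∑ p, g k i p * conj (g k i p)) - γ k i) * ((μ i : ℂ) / μ k - 1)).re := by
    have h := sum_mul_div_sub_one_nonneg μ hμ
      (fun k i => ((∑ p, g k i p * conj (g k i p)) - γ k i).re)
      (fun k i => by
        have : γ k i = γ i k := wirtM_wirtM_diag_symm hG hGH hGK k i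
        simp only [this, hgs k i])
      (fun k i hki => by
        have := hR i k (Ne.symm hki)
        rw [Matrix.sub_apply, Matrix.mul_apply] at this
        simpa only [hgbar] using this)
    refine h.trans_eq ?_
    simp only [Complex.re_sum]
    refine Finset.sum_congr rfl fun k _ => Finset.sum_congr rfl fun i _ => ?_
    have e : ((μ i : ℂ) / μ k - 1) = ((μ i / μ k - 1 : ℝ) : ℂ) := by push_cast; ring
    rw [e, Complex.re_mul_ofReal, Complex.sub_re, Complex.re_sum]
  -- Of the nonnegative squares only those with `i = k` are kept; they suffice against the gradient
  -- of `log f`.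
  have hT : ∑ p, ∑ k, ‖w p k k - g p k k * μ k‖ ^ 2 / (μ k * μ k) ≤ (∑ p, ∑ k, ∑ i,
      (w p k i - g p k i * μ i) * conj (w p k i - g p k i * μ i) / ((μ k : ℂ) * μ i)).re := by
    simp only [Complex.re_sum]
    refine Finset.sum_le_sum fun p _ => Finset.sum_le_sum fun k _ => ?_
    have e : ∀ i, ((w p k i - g p k i * μ i) * conj (w p k i - g p k i * μ i) /
        ((μ k : ℂ) * μ i)).re = ‖w p k i - g p k i * μ i‖ ^ 2 / (μ k * μ i) := fun i => by
      rw [Complex.mul_conj, Complex.normSq_eq_norm_sq, ← Complex.ofReal_mul, ← Complex.ofReal_div,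
        Complex.ofReal_re]
    simp only [e]
    exact Finset.single_le_sum (f := fun i => ‖w p k i - g p k i * μ i‖ ^ 2 / (μ k * μ i))
      (fun i _ => by have := hμ i; have := hμ k; positivity) (Finset.mem_univ k)
  have hsum : ∑ k, (wirt (-Complex.I) (v k) (wirt Complex.I (v k) u) z).re / μ k =
      (∑ k, wirt (-Complex.I) (v k) (wirt Complex.I (v k) u) z / μ k).re := by
    rw [Complex.re_sum]
    exact Finset.sum_congr rfl fun k _ => by rw [Complex.div_ofReal_re]
  rw [hsum, key, Complex.add_re, Complex.add_re, Complex.re_sum (f := Q)]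
  have hQs := Finset.sum_le_sum fun p (_ : p ∈ Finset.univ) => hQre p
  simp only [Finset.sum_sub_distrib, ← Finset.mul_sum] at hQs
  linarith

end PointwiseInequality

/-! ### Interior gradient estimate and interpolation on complex lines -/

section Interpolation

/-- A positive second derivative would make the point a local minimum too, so the function would be
locally constant and `c = 0`. -/
theorem IsLocalMax.second_deriv_nonpos {p p' : ℝ → ℝ} {c x₀ : ℝ} (h : IsLocalMax p x₀)
    (hp : ∀ᶠ x in 𝓝 x₀, HasDerivAt p (p' x) x) (hp' : HasDerivAt p' c x₀) : c ≤ 0 := by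
  by_contra! hc
  have e1 : deriv p =ᶠ[𝓝 x₀] p' := by
    filter_upwards [hp] with x hx using hx.deriv
  have e2 : deriv (deriv p) x₀ = c := by rw [e1.deriv_eq, hp'.deriv]
  have hmin : IsLocalMin p x₀ := isLocalMin_of_deriv_deriv_pos (by rw [e2]; exact hc)
    h.deriv_eq_zero hp.self_of_nhds.continuousAt
  have e3 : p =ᶠ[𝓝 x₀] fun _ => p x₀ := by
    filter_upwards [h, hmin] with x h1 h2 using le_antisymm h1 h2
  have e4 : deriv (deriv p) x₀ = 0 := by
    rw [e3.deriv.deriv_eq]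
    simp
  linarith

/-- One half of the interior gradient estimate for Poisson's equation on a square, by comparison
with a barrier. -/
theorem partial_deriv_le_of_laplacian_lt {q q1 q11 q2 q22 : ℝ → ℝ → ℝ} {d M N : ℝ} (hd : 0 < d)
    (hcont : ContinuousOn (fun p : ℝ × ℝ => q p.1 p.2) (Set.Icc (-d) d ×ˢ Set.Icc (-d) d))
    (h1 : ∀ x ∈ Set.Icc (-d) d, ∀ y ∈ Set.Icc (-d) d, HasDerivAt (fun s => q s y) (q1 x y) x)
    (h11 : ∀ x ∈ Set.Icc (-d) d, ∀ y ∈ Set.Icc (-d) d, HasDerivAt (fun s => q1 s y) (q11 x y) x)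
    (h2 : ∀ x ∈ Set.Icc (-d) d, ∀ y ∈ Set.Icc (-d) d, HasDerivAt (fun s => q x s) (q2 x y) y)
    (h22 : ∀ x ∈ Set.Icc (-d) d, ∀ y ∈ Set.Icc (-d) d, HasDerivAt (fun s => q2 x s) (q22 x y) y)
    (hM : ∀ x ∈ Set.Icc (-d) d, ∀ y ∈ Set.Icc (-d) d, |q x y| ≤ M)
    (hN : ∀ x ∈ Set.Icc (-d) d, ∀ y ∈ Set.Icc (-d) d, |q11 x y + q22 x y| < N) :
    q1 0 0 ≤ 2 * M / d + N * d / 2 := by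
  have hd0 : (0 : ℝ) ∈ Set.Icc (-d) d := ⟨by linarith, hd.le⟩
  have hM0 : 0 ≤ M := (abs_nonneg _).trans (hM 0 hd0 0 hd0)
  have hN0 : 0 < N := (abs_nonneg _).trans_lt (hN 0 hd0 0 hd0)
  have neg_mem : ∀ {x : ℝ}, x ∈ Set.Icc (-d) d → -x ∈ Set.Icc (-d) d := fun hx =>
    ⟨by linarith [hx.2], by linarith [hx.1]⟩
  -- The first summand is harmonic, so `ΔΨ = -N`. On the boundary of `[0,d] × [-d,d]`, `Ψ` is
  -- nonnegative, and at least `M` on the three sides other than `x = 0`. Its `x`-derivative at the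
  -- origin is the asserted bound. The odd part of `q` vanishes on `x = 0`.
  set Ψ : ℝ → ℝ → ℝ := fun x y => M / d ^ 2 * (y ^ 2 + x * (2 * d - x)) + N / 2 * (x * (d - x))
    with hΨ
  set D : ℝ → ℝ → ℝ := fun x y => (q x y - q (-x) y) / 2 - Ψ x y with hD
  have hsub : ∀ {x : ℝ}, x ∈ Set.Icc 0 d → x ∈ Set.Icc (-d) d := fun hx =>
    ⟨by linarith [hx.1], hx.2⟩
  have hDcont : ContinuousOn (fun p : ℝ × ℝ => D p.1 p.2) (Set.Icc 0 d ×ˢ Set.Icc (-d) d) := by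
    have c1 : ContinuousOn (fun p : ℝ × ℝ => q p.1 p.2) (Set.Icc 0 d ×ˢ Set.Icc (-d) d) :=
      hcont.mono fun p hp => ⟨hsub hp.1, hp.2⟩
    have c2 : ContinuousOn (fun p : ℝ × ℝ => q (-p.1) p.2) (Set.Icc 0 d ×ˢ Set.Icc (-d) d) :=
      hcont.comp (f := fun p : ℝ × ℝ => (-p.1, p.2)) (by fun_prop)
        fun p hp => ⟨neg_mem (hsub hp.1), hp.2⟩
    exact ((c1.sub c2).div_const 2).sub (by simp only [hΨ]; fun_prop)
  obtain ⟨⟨x₀, y₀⟩, ⟨hx₀, hy₀⟩, hmax⟩ := (isCompact_Icc.prod isCompact_Icc).exists_isMaxOn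
    (⟨(0, 0), ⟨⟨le_rfl, hd.le⟩, hd0⟩⟩ : (Set.Icc 0 d ×ˢ Set.Icc (-d) d).Nonempty) hDcont
  simp only at hx₀ hy₀
  have hmax' : ∀ x ∈ Set.Icc 0 d, ∀ y ∈ Set.Icc (-d) d, D x y ≤ D x₀ y₀ := fun x hx y hy =>
    hmax (⟨hx, hy⟩ : (x, y) ∈ Set.Icc 0 d ×ˢ Set.Icc (-d) d)
  have hle : D x₀ y₀ ≤ 0 := by
    by_contra! hpos
    have hw : (q x₀ y₀ - q (-x₀) y₀) / 2 ≤ M := by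
      have a1 := abs_le.1 (hM x₀ (hsub hx₀) y₀ hy₀)
      have a2 := abs_le.1 (hM (-x₀) (neg_mem (hsub hx₀)) y₀ hy₀)
      linarith
    have hlast : 0 ≤ N / 2 * (x₀ * (d - x₀)) := by
      have := sub_nonneg.2 hx₀.2
      have := hx₀.1
      positivity
    -- Otherwise `Ψ ≥ M`, which dominates the odd part. The strict inequality keeps a positive
    -- maximum off the three outer sides, so the second derivative test applies.
    have hbig : y₀ ^ 2 + x₀ * (2 * d - x₀) < d ^ 2 := by
      by_contra! hge
      have : M ≤ M / d ^ 2 * (y₀ ^ 2 + x₀ * (2 * d - x₀)) := by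
        calc M = M / d ^ 2 * d ^ 2 := by field_simp
          _ ≤ _ := by gcongr
      simp only [hD, hΨ] at hpos
      linarith
    have hx0 : 0 < x₀ := by
      refine lt_of_le_of_ne hx₀.1 fun h => ?_
      subst h
      simp only [hD, hΨ, neg_zero, sub_self, zero_div, zero_mul, mul_zero, add_zero] at hpos
      have : 0 ≤ M / d ^ 2 * y₀ ^ 2 := by positivity
      linarith
    have hxd : x₀ < d := by
      refine lt_of_le_of_ne hx₀.2 fun h => ?_
      subst h
      nlinarith [sq_nonneg y₀]
    have hyd : y₀ ^ 2 < d ^ 2 := by nlinarith [mul_nonneg hx₀.1 (by linarith : 0 ≤ 2 * d - x₀)]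
    have hy' := abs_lt_of_sq_lt_sq' hyd hd.le
    have nx : Set.Icc 0 d ∈ 𝓝 x₀ := Icc_mem_nhds hx0 hxd
    have ny : Set.Icc (-d) d ∈ 𝓝 y₀ := Icc_mem_nhds hy'.1 hy'.2
    have s1 : IsLocalMax (fun x => D x y₀) x₀ := by
      filter_upwards [nx] with x hx using hmax' x hx y₀ hy₀
    have s2 : IsLocalMax (fun y => D x₀ y) y₀ := by
      filter_upwards [ny] with y hy using hmax' x₀ hx₀ y hy
    have t1 : (q11 x₀ y₀ - q11 (-x₀) y₀) / 2 - (M / d ^ 2 * (-2) + N / 2 * (-2)) ≤ 0 := by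
      refine s1.second_deriv_nonpos (p' := fun x => (q1 x y₀ + q1 (-x) y₀) / 2 -
        (M / d ^ 2 * (2 * d - 2 * x) + N / 2 * (d - 2 * x))) ?_ ?_
      · filter_upwards [nx] with x hx
        have a1 := h1 x (hsub hx) y₀ hy₀
        have a2 := (h1 (-x) (neg_mem (hsub hx)) y₀ hy₀).comp x (hasDerivAt_neg x)
        have a3 : HasDerivAt (fun x => Ψ x y₀)
            (M / d ^ 2 * (2 * d - 2 * x) + N / 2 * (d - 2 * x)) x := by
          have i := hasDerivAt_id' x
          have b1 := ((i.mul (i.const_sub (2 * d))).const_add (y₀ ^ 2)).const_mul (M / d ^ 2)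
          have b2 := (i.mul (i.const_sub d)).const_mul (N / 2)
          exact (b1.add b2).congr_deriv (by ring)
        exact (((a1.sub a2).div_const 2).sub a3).congr_deriv (by ring)
      · have a1 := h11 x₀ (hsub hx₀) y₀ hy₀
        have a2 := (h11 (-x₀) (neg_mem (hsub hx₀)) y₀ hy₀).comp x₀ (hasDerivAt_neg x₀)
        have i := (hasDerivAt_id' x₀).const_mul 2
        have b1 := (i.const_sub (2 * d)).const_mul (M / d ^ 2)
        have b2 := (i.const_sub d).const_mul (N / 2)
        exact (((a1.add a2).div_const 2).sub (b1.add b2)).congr_deriv (by ring)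
    have t2 : (q22 x₀ y₀ - q22 (-x₀) y₀) / 2 - M / d ^ 2 * 2 ≤ 0 := by
      refine s2.second_deriv_nonpos (p' := fun y => (q2 x₀ y - q2 (-x₀) y) / 2 -
        M / d ^ 2 * (2 * y)) ?_ ?_
      · filter_upwards [ny] with y hy
        have a1 := h2 x₀ (hsub hx₀) y hy
        have a2 := h2 (-x₀) (neg_mem (hsub hx₀)) y hy
        have a3 : HasDerivAt (fun y => Ψ x₀ y) (M / d ^ 2 * (2 * y)) y := by
          have i := hasDerivAt_id' y
          exact ((((i.pow 2).add_const (x₀ * (2 * d - x₀))).const_mul (M / d ^ 2)).add_const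
            (N / 2 * (x₀ * (d - x₀)))).congr_deriv (by push_cast; ring)
        exact ((a1.sub a2).div_const 2).sub a3
      · have a1 := h22 x₀ (hsub hx₀) y₀ hy₀
        have a2 := h22 (-x₀) (neg_mem (hsub hx₀)) y₀ hy₀
        have i := (hasDerivAt_id' y₀).const_mul 2
        exact (((a1.sub a2).div_const 2).sub (i.const_mul (M / d ^ 2))).congr_deriv (by ring)
    have n1 := abs_lt.1 (hN x₀ (hsub hx₀) y₀ hy₀)
    have n2 := abs_lt.1 (hN (-x₀) (neg_mem (hsub hx₀)) y₀ hy₀)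
    linarith
  have hder : HasDerivAt (fun x => D x 0) (q1 0 0 - (2 * M / d + N * d / 2)) 0 := by
    have a1 := h1 0 hd0 0 hd0
    have a2 : HasDerivAt (fun x => q (-x) 0) (q1 0 0 * (-1)) 0 := by
      have h := h1 (-0) (by simpa using hd0) 0 hd0
      have h' := h.comp 0 (hasDerivAt_neg 0)
      rw [neg_zero] at h'
      exact h'
    have a3 : HasDerivAt (fun x => Ψ x 0) (2 * M / d + N * d / 2) 0 := by
      have i := hasDerivAt_id' (0 : ℝ)
      have b1 := ((i.mul (i.const_sub (2 * d))).const_add ((0 : ℝ) ^ 2)).const_mul (M / d ^ 2)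
      have b2 := (i.mul (i.const_sub d)).const_mul (N / 2)
      exact (b1.add b2).congr_deriv (by field_simp; ring)
    exact (((a1.sub a2).div_const 2).sub a3).congr_deriv (by ring)
  have hD0 : D 0 0 = 0 := by simp [hD, hΨ]
  -- `D ≤ 0` with equality at the origin, which lies on the boundary; hence only the one-sided
  -- derivative is controlled.
  have hmax0 : IsLocalMaxOn (fun x => D x 0) (Set.Icc 0 d) 0 := by
    filter_upwards [self_mem_nhdsWithin] with x hx
    rw [hD0]
    exact (hmax' x hx 0 hd0).trans hle
  have hcone : (1 : ℝ) ∈ posTangentConeAt (Set.Icc (0 : ℝ) d) 0 := by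
    refine mem_posTangentConeAt_of_frequently_mem (Eventually.frequently ?_)
    have : Set.Ioo 0 d ∈ 𝓝[>] (0 : ℝ) := Ioo_mem_nhdsGT hd
    filter_upwards [this] with t ht
    simpa using ⟨ht.1.le, ht.2.le⟩
  have := hmax0.hasFDerivWithinAt_nonpos hder.hasFDerivAt.hasFDerivWithinAt hcone
  simp at this
  linarith

theorem abs_partial_deriv_le_of_laplacian_lt {q q1 q11 q2 q22 : ℝ → ℝ → ℝ} {d M N : ℝ} (hd : 0 < d)
    (hcont : ContinuousOn (fun p : ℝ × ℝ => q p.1 p.2) (Set.Icc (-d) d ×ˢ Set.Icc (-d) d))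
    (h1 : ∀ x ∈ Set.Icc (-d) d, ∀ y ∈ Set.Icc (-d) d, HasDerivAt (fun s => q s y) (q1 x y) x)
    (h11 : ∀ x ∈ Set.Icc (-d) d, ∀ y ∈ Set.Icc (-d) d, HasDerivAt (fun s => q1 s y) (q11 x y) x)
    (h2 : ∀ x ∈ Set.Icc (-d) d, ∀ y ∈ Set.Icc (-d) d, HasDerivAt (fun s => q x s) (q2 x y) y)
    (h22 : ∀ x ∈ Set.Icc (-d) d, ∀ y ∈ Set.Icc (-d) d, HasDerivAt (fun s => q2 x s) (q22 x y) y)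
    (hM : ∀ x ∈ Set.Icc (-d) d, ∀ y ∈ Set.Icc (-d) d, |q x y| ≤ M)
    (hN : ∀ x ∈ Set.Icc (-d) d, ∀ y ∈ Set.Icc (-d) d, |q11 x y + q22 x y| < N) :
    |q1 0 0| ≤ 2 * M / d + N * d / 2 := by
  refine abs_le'.2 ⟨partial_deriv_le_of_laplacian_lt hd hcont h1 h11 h2 h22 hM hN, ?_⟩
  refine partial_deriv_le_of_laplacian_lt (q := fun x y => -q x y) (q1 := fun x y => -q1 x y)
    (q11 := fun x y => -q11 x y) (q2 := fun x y => -q2 x y) (q22 := fun x y => -q22 x y)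
    hd hcont.neg
    (fun x hx y hy => (h1 x hx y hy).neg) (fun x hx y hy => (h11 x hx y hy).neg)
    (fun x hx y hy => (h2 x hx y hy).neg) (fun x hx y hy => (h22 x hx y hy).neg)
    (fun x hx y hy => by rw [abs_neg]; exact hM x hx y hy)
    (fun x hx y hy => by rw [← neg_add, abs_neg]; exact hN x hx y hy)

theorem hasDerivAt_fderiv_apply {E : Type*} [NormedAddCommGroup E] [NormedSpace ℝ E] {F : E → ℝ}
    {c : ℝ → E} {c' x : E} {t : ℝ} (hc : HasDerivAt c c' t) (hF : ContDiffAt ℝ 2 F (c t)) :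
    HasDerivAt (fun s => fderiv ℝ F (c s) x) (fderiv ℝ (fderiv ℝ F) (c t) c' x) t := by
  have hd : HasFDerivAt (fderiv ℝ F) (fderiv ℝ (fderiv ℝ F) (c t)) (c t) :=
    ((hF.fderiv_right (m := 1) (by norm_num)).differentiableAt (by norm_num)).hasFDerivAt
  simpa using (hd.comp_hasDerivAt t hc).clm_apply (hasDerivAt_const t x)

theorem hasDerivAt_add_smul {E : Type*} [NormedAddCommGroup E] [NormedSpace ℝ E] (z x : E)
    (t : ℝ) : HasDerivAt (fun s : ℝ => z + s • x) x t := by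
  simpa using ((hasDerivAt_id t).smul_const x).const_add z

variable {m : ℕ} {F : CSpace m → ℝ} {z v : CSpace m}

theorem wirt_ofReal (hF : DifferentiableAt ℝ F z) :
    wirt (-Complex.I) v (fun y => (F y : ℂ)) z =
      ((fderiv ℝ F z v : ℝ) - Complex.I * (fderiv ℝ F z (Complex.I • v) : ℝ)) / 2 := by
  have h : HasFDerivAt (fun y => (F y : ℂ)) (Complex.ofRealCLM.comp (fderiv ℝ F z)) z :=
    Complex.ofRealCLM.hasFDerivAt.comp z hF.hasFDerivAt
  simp only [wirt, h.fderiv, ContinuousLinearMap.comp_apply, Complex.ofRealCLM_apply]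
  ring

theorem ContDiffAt.ofReal_comp {k : WithTop ℕ∞} (hF : ContDiffAt ℝ k F z) :
    ContDiffAt ℝ k (fun y => (F y : ℂ)) z :=
  Complex.ofRealCLM.contDiff.contDiffAt.comp z hF

/-- Symmetry of the second derivative cancels the mixed terms, leaving a quarter of the real
Laplacian on the complex line through `v`. -/
theorem wirt_wirt_ofReal (hF : ContDiffAt ℝ 2 F z) :
    wirt (-Complex.I) v (wirt Complex.I v fun y => (F y : ℂ)) z =
      (((fderiv ℝ (fderiv ℝ F) z v v +
        fderiv ℝ (fderiv ℝ F) z (Complex.I • v) (Complex.I • v)) / 4 : ℝ) : ℂ) := by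
  have hF' := hF.ofReal_comp
  have hs : IsSymmSndFDerivAt ℝ (fun y => (F y : ℂ)) z := hF'.isSymmSndFDerivAt (by simp)
  have e : fderiv ℝ (fun y => (F y : ℂ)) =ᶠ[𝓝 z]
      fun y => Complex.ofRealCLM.comp (fderiv ℝ F y) := by
    filter_upwards [hF.eventually (by simp)] with y hy
    exact (Complex.ofRealCLM.hasFDerivAt.comp y
      (hy.differentiableAt (by norm_num)).hasFDerivAt).fderiv
  have hd : DifferentiableAt ℝ (fderiv ℝ F) z :=
    (hF.fderiv_right (m := 1) (by norm_num)).differentiableAt (by norm_num)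
  have e2 : ∀ x y, fderiv ℝ (fderiv ℝ fun y => (F y : ℂ)) z x y =
      ((fderiv ℝ (fderiv ℝ F) z x y : ℝ) : ℂ) := by
    intro x y
    rw [e.fderiv_eq, fderiv_clm_comp (differentiableAt_const _) hd]
    simp
  rw [wirt_wirt hF', hs.eq (Complex.I • v) v, e2, e2, e2]
  push_cast
  linear_combination (-(fderiv ℝ (fderiv ℝ F) z (Complex.I • v) (Complex.I • v) : ℂ) / 4) *
    Complex.I_sq

theorem IsLocalMax.wirt_wirt_re_nonpos (h : IsLocalMax F z) (hF : ContDiffAt ℝ 2 F z) :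
    (wirt (-Complex.I) v (wirt Complex.I v fun y => (F y : ℂ)) z).re ≤ 0 := by
  have key : ∀ x, fderiv ℝ (fderiv ℝ F) z x x ≤ 0 := by
    intro x
    have hl : ∀ t : ℝ, HasDerivAt (fun t : ℝ => z + t • x) x t := hasDerivAt_add_smul z x
    have ht : Tendsto (fun t : ℝ => z + t • x) (𝓝 0) (𝓝 z) := by
      simpa using (hl 0).continuousAt.tendsto
    refine IsLocalMax.second_deriv_nonpos (p := fun t : ℝ => F (z + t • x))
      (p' := fun t : ℝ => fderiv ℝ F (z + t • x) x) (x₀ := 0) ?_ ?_ ?_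
    · filter_upwards [ht.eventually h] with t hy
      simpa using hy
    · filter_upwards [ht.eventually (hF.eventually (by simp))] with t hy
      exact (hy.differentiableAt (by norm_num)).hasFDerivAt.comp_hasDerivAt t (hl t)
    · have h0 : z + (0 : ℝ) • x = z := by simp
      have := hasDerivAt_fderiv_apply (x := x) (hl 0) (F := F) (by rw [h0]; exact hF)
      rwa [h0] at this
  rw [wirt_wirt_ofReal hF, Complex.ofReal_re]
  linarith [key v, key (Complex.I • v)]

/-- Interpolation along a complex line: the gradient is controlled by the oscillation and the
square root of the complex Hessian. -/
theorem norm_sq_wirt_le {r K L B : ℝ} (hr : 0 < r) (hK : 1 ≤ K)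
    (hF : ∀ x y : ℝ, |x| ≤ r → |y| ≤ r → ContDiffAt ℝ 2 F (z + x • v + y • (Complex.I • v)))
    (hL : ∀ x y : ℝ, |x| ≤ r → |y| ≤ r → |F (z + x • v + y • (Complex.I • v)) - F z| ≤ L)
    (hH : ∀ x y : ℝ, |x| ≤ r → |y| ≤ r → ‖wirt (-Complex.I) v (wirt Complex.I v fun y => (F y : ℂ))
      (z + x • v + y • (Complex.I • v))‖ ≤ B * K) :
    ‖wirt (-Complex.I) v (fun y => (F y : ℂ)) z‖ ^ 2 ≤ (2 * L / r + 2 * (B + 1) * r) ^ 2 * K := by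
  have hK0 : 0 < K := by linarith
  have hsK : 0 < √K := Real.sqrt_pos.2 hK0
  have hsK1 : 1 ≤ √K := Real.one_le_sqrt.2 hK
  -- A square of this size balances the two terms `L/d` and `K d` of the gradient estimate, both
  -- becoming multiples of `√K`. The condition `K ≥ 1` keeps it inside the square of size `r`.
  set d := r / √K with hd
  have hd0 : 0 < d := by positivity
  have hdr : d ≤ r := div_le_self hr.le hsK1
  have hmem : ∀ {x : ℝ}, x ∈ Set.Icc (-d) d → |x| ≤ r := fun hx => (abs_le.2 hx).trans hdr
  set ℓ : ℝ → ℝ → CSpace m := fun x y => z + x • v + y • (Complex.I • v) with hℓ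
  have hl1 : ∀ x y : ℝ, HasDerivAt (fun s => ℓ s y) v x := fun x y =>
    (hasDerivAt_add_smul z v x).add_const (y • (Complex.I • v))
  have hl2 : ∀ x y : ℝ, HasDerivAt (fun s => ℓ x s) (Complex.I • v) y := fun x y =>
    hasDerivAt_add_smul (z + x • v) (Complex.I • v) y
  have dF : ∀ x y : ℝ, |x| ≤ r → |y| ≤ r → HasFDerivAt F (fderiv ℝ F (ℓ x y)) (ℓ x y) :=
    fun x y hx hy => ((hF x y hx hy).differentiableAt (by norm_num)).hasFDerivAt
  have hcont : ContinuousOn (fun p : ℝ × ℝ => F (ℓ p.1 p.2) - F z)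
      (Set.Icc (-d) d ×ˢ Set.Icc (-d) d) := by
    intro p hp
    have c1 : ContinuousAt F (ℓ p.1 p.2) := (dF _ _ (hmem hp.1) (hmem hp.2)).continuousAt
    have c2 : ContinuousAt (fun p : ℝ × ℝ => ℓ p.1 p.2) p := by
      simp only [hℓ]; fun_prop
    exact ((c1.comp (f := fun p : ℝ × ℝ => ℓ p.1 p.2) c2).sub
      continuousAt_const).continuousWithinAt
  have k1 : ∀ x ∈ Set.Icc (-d) d, ∀ y ∈ Set.Icc (-d) d,
      HasDerivAt (fun s => F (ℓ s y) - F z) (fderiv ℝ F (ℓ x y) v) x := fun x hx y hy =>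
    ((dF x y (hmem hx) (hmem hy)).comp_hasDerivAt x (hl1 x y)).sub_const _
  have k2 : ∀ x ∈ Set.Icc (-d) d, ∀ y ∈ Set.Icc (-d) d,
      HasDerivAt (fun s => F (ℓ x s) - F z) (fderiv ℝ F (ℓ x y) (Complex.I • v)) y :=
    fun x hx y hy => ((dF x y (hmem hx) (hmem hy)).comp_hasDerivAt y (hl2 x y)).sub_const _
  have k11 : ∀ x ∈ Set.Icc (-d) d, ∀ y ∈ Set.Icc (-d) d,
      HasDerivAt (fun s => fderiv ℝ F (ℓ s y) v) (fderiv ℝ (fderiv ℝ F) (ℓ x y) v v) x :=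
    fun x hx y hy => hasDerivAt_fderiv_apply (hl1 x y) (hF x y (hmem hx) (hmem hy))
  have k22 : ∀ x ∈ Set.Icc (-d) d, ∀ y ∈ Set.Icc (-d) d,
      HasDerivAt (fun s => fderiv ℝ F (ℓ x s) (Complex.I • v))
        (fderiv ℝ (fderiv ℝ F) (ℓ x y) (Complex.I • v) (Complex.I • v)) y :=
    fun x hx y hy => hasDerivAt_fderiv_apply (hl2 x y) (hF x y (hmem hx) (hmem hy))
  have kM : ∀ x ∈ Set.Icc (-d) d, ∀ y ∈ Set.Icc (-d) d, |F (ℓ x y) - F z| ≤ L :=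
    fun x hx y hy => hL x y (hmem hx) (hmem hy)
  -- The factor `4` is the ratio of the real Laplacian to `∂∂̄`; `B + 1` in place of `B` makes the
  -- inequality strict, as the barrier argument requires.
  have kN : ∀ x ∈ Set.Icc (-d) d, ∀ y ∈ Set.Icc (-d) d,
      |fderiv ℝ (fderiv ℝ F) (ℓ x y) v v +
        fderiv ℝ (fderiv ℝ F) (ℓ x y) (Complex.I • v) (Complex.I • v)| < 4 * ((B + 1) * K) := by
    intro x hx y hy
    have h := hH x y (hmem hx) (hmem hy)
    rw [wirt_wirt_ofReal (hF x y (hmem hx) (hmem hy)), Complex.norm_real, Real.norm_eq_abs,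
      abs_div, abs_of_pos (by norm_num : (0 : ℝ) < 4)] at h
    rw [div_le_iff₀ (by norm_num)] at h
    refine h.trans_lt ?_
    linarith
  have hz : ℓ 0 0 = z := by simp [hℓ]
  have r1 := abs_partial_deriv_le_of_laplacian_lt hd0 hcont k1 k11 k2 k22 kM kN
  -- The same estimate with the two real coordinates exchanged bounds the derivative along `√-1 v`.
  have r2 := abs_partial_deriv_le_of_laplacian_lt
    (q := fun x y => F (ℓ y x) - F z)
    (q1 := fun x y => fderiv ℝ F (ℓ y x) (Complex.I • v))
    (q11 := fun x y => fderiv ℝ (fderiv ℝ F) (ℓ y x) (Complex.I • v) (Complex.I • v))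
    (q2 := fun x y => fderiv ℝ F (ℓ y x) v)
    (q22 := fun x y => fderiv ℝ (fderiv ℝ F) (ℓ y x) v v) hd0
    (hcont.comp (f := Prod.swap) continuous_swap.continuousOn fun p hp => ⟨hp.2, hp.1⟩)
    (fun x hx y hy => k2 y hy x hx) (fun x hx y hy => k22 y hy x hx)
    (fun x hx y hy => k1 y hy x hx) (fun x hx y hy => k11 y hy x hx)
    (fun x hx y hy => kM y hy x hx) (fun x hx y hy => by rw [add_comm]; exact kN y hy x hx)
  simp only [hz] at r1 r2
  have hbound : 2 * L / d + 4 * ((B + 1) * K) * d / 2 = (2 * L / r + 2 * (B + 1) * r) * √K := by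
    have hKs : K = √K * √K := (Real.mul_self_sqrt hK0.le).symm
    rw [hd]
    conv_lhs => rw [hKs]
    rw [Real.sqrt_mul_self hsK.le]
    field_simp
    ring
  rw [hbound] at r1 r2
  set T := (2 * L / r + 2 * (B + 1) * r) with hT
  have hz0 := hF 0 0 (by simpa using hr.le) (by simpa using hr.le)
  simp only [zero_smul, add_zero] at hz0
  rw [wirt_ofReal (hz0.differentiableAt (by norm_num)), ← Complex.normSq_eq_norm_sq]
  set a := fderiv ℝ F z v
  set b := fderiv ℝ F z (Complex.I • v)
  have e : Complex.normSq (((a : ℂ) - Complex.I * b) / 2) = (a ^ 2 + b ^ 2) / 4 := by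
    simp [Complex.normSq_apply]
    ring
  have s1 : a ^ 2 ≤ (T * √K) ^ 2 := sq_le_sq' (neg_le_of_abs_le r1) (le_of_abs_le r1)
  have s2 : b ^ 2 ≤ (T * √K) ^ 2 := sq_le_sq' (neg_le_of_abs_le r2) (le_of_abs_le r2)
  have s3 : (T * √K) ^ 2 = T ^ 2 * K := by rw [mul_pow, Real.sq_sqrt hK0.le]
  rw [s3] at s1 s2
  rw [e]
  have : 0 ≤ T ^ 2 * K := by positivity
  linarith

end Interpolation

/-! ### Composition with holomorphic maps -/

section Holomorphic

variable {m : ℕ} {τ : CSpace m → CSpace m} {z v w : CSpace m} {F : CSpace m → ℂ} {c : ℂ}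

theorem wirt_comp_holomorphic (hF : DifferentiableAt ℝ F (τ z)) (hτ : DifferentiableAt ℂ τ z) :
    wirt c v (fun y => F (τ y)) z = wirt c (fderiv ℂ τ z v) F (τ z) := by
  have h : HasFDerivAt (fun y => F (τ y))
      ((fderiv ℝ F (τ z)).comp ((fderiv ℂ τ z).restrictScalars ℝ)) z :=
    hF.hasFDerivAt.comp z (hτ.hasFDerivAt.restrictScalars ℝ)
  simp [wirt, h.fderiv]

theorem wirt_anti_holomorphic {f : CSpace m → ℂ} (hf : DifferentiableAt ℂ f z) :
    wirt (-Complex.I) v (fun y => conj (f y)) z = 0 := by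
  have h : HasFDerivAt f ((fderiv ℂ f z).restrictScalars ℝ) z := hf.hasFDerivAt.restrictScalars ℝ
  have e : wirt Complex.I v f z = 0 := by
    simp only [wirt, h.fderiv, ContinuousLinearMap.coe_restrictScalars', map_smul, smul_eq_mul]
    linear_combination (fderiv ℂ f z v) / 2 * Complex.I_sq
  have := conj_wirt (c := Complex.I) (v := v) h.differentiableAt
  rw [e, map_zero, Complex.conj_I] at this
  exact this.symm

/-- The Jacobian matrix of a holomorphic map. -/
def jacobian (τ : CSpace m → CSpace m) (z : CSpace m) : Matrix (Fin m) (Fin m) ℂ :=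
  Matrix.of fun k i => fderiv ℂ τ z (EuclideanSpace.single i 1) k

/-- The complex Hessian is tensorial: the derivative `∂_i` of the antiholomorphic factor `conj (∂_j
τ)` vanishes, so no first order term in `F` appears. -/
theorem dz_dzbar_comp_holomorphic (hF : ContDiffAt ℝ 2 F (τ z)) (hτ : ContDiffAt ℂ 2 τ z)
    (i j : Fin m) :
    dz i (dzbar j fun y => F (τ y)) z =
      ((jacobian τ z)ᵀ * (Matrix.of fun k l => dz k (dzbar l F) (τ z)) *
        (jacobian τ z).map conj) i j := by
  have hτd : DifferentiableAt ℂ τ z := hτ.differentiableAt (by norm_num)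
  have hJ : ∀ l, DifferentiableAt ℂ (fun y => fderiv ℂ τ y (EuclideanSpace.single j 1) l) z := by
    intro l
    have h1 : DifferentiableAt ℂ (fderiv ℂ τ) z :=
      (hτ.fderiv_right (m := 1) (by norm_num)).differentiableAt (by norm_num)
    have h2 : DifferentiableAt ℂ (fun y => fderiv ℂ τ y (EuclideanSpace.single j 1)) z :=
      h1.clm_apply (differentiableAt_const _)
    exact (EuclideanSpace.proj l : CSpace m →L[ℂ] ℂ).differentiableAt.comp z h2
  have hJr : ∀ l, DifferentiableAt ℝ
      (fun y => conj (fderiv ℂ τ y (EuclideanSpace.single j 1) l)) z := fun l =>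
    (Complex.conjCLE : ℂ →L[ℝ] ℂ).differentiableAt.comp z ((hJ l).restrictScalars ℝ)
  have hD : ∀ l, DifferentiableAt ℝ (dzbar l F) (τ z) := fun l => by
    rw [dzbar_eq_wirt]
    exact (hF.wirt (k := 1) (by norm_num)).differentiableAt (by norm_num)
  have hDτ : ∀ l, DifferentiableAt ℝ (fun y => dzbar l F (τ y)) z := fun l =>
    (hD l).comp z (hτd.restrictScalars ℝ)
  have e1 : dzbar j (fun y => F (τ y)) =ᶠ[𝓝 z] fun y =>
      ∑ l, conj (fderiv ℂ τ y (EuclideanSpace.single j 1) l) * dzbar l F (τ y) := by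
    have t1 := hτ.eventually (by simp)
    have t2 := hτ.continuousAt.eventually (hF.eventually (by simp))
    filter_upwards [t1, t2] with y h1 h2
    rw [dzbar_eq_wirt, wirt_comp_holomorphic (h2.differentiableAt (by norm_num))
      (h1.differentiableAt (by norm_num)), wirt_anti_eq_sum]
  rw [dz_eq_wirt, wirt_congr e1, wirt_sum _ fun l _ => (hJr l).fun_mul (hDτ l)]
  have e2 : ∀ l, wirt (-Complex.I) (EuclideanSpace.single i 1)
      (fun y => conj (fderiv ℂ τ y (EuclideanSpace.single j 1) l) * dzbar l F (τ y)) z =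
      conj (jacobian τ z l j) * ∑ k, jacobian τ z k i * dz k (dzbar l F) (τ z) := fun l => by
    rw [wirt_mul (hJr l) (hDτ l), wirt_anti_holomorphic (hJ l),
      wirt_comp_holomorphic (hD l) hτd, wirt_holo_eq_sum, zero_mul, zero_add]
    rfl
  simp only [e2, Matrix.mul_apply, Matrix.transpose_apply, Matrix.map_apply, Matrix.of_apply]
  exact Finset.sum_congr rfl fun l _ => mul_comm _ _

end Holomorphic

/-! ### Forms and functions read in a chart -/

section PlainCharts

variable {m : ℕ} {M : Type*} [TopologicalSpace M]
  {e e' : OpenPartialHomeomorph M (CSpace m)} {z : CSpace m}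

theorem comp_symm_eventuallyEq (u : M → ℝ) (hz : z ∈ e.target) (hz' : e.symm z ∈ e'.source) :
    (fun y => u (e.symm y)) =ᶠ[𝓝 z] fun y => u (e'.symm (e' (e.symm y))) := by
  have : ∀ᶠ y in 𝓝 z, e.symm y ∈ e'.source :=
    (e.continuousAt_symm hz).eventually (e'.open_source.mem_nhds hz')
  filter_upwards [this] with y hy
  rw [e'.left_inv hy]

variable [ChartedSpace (CSpace m) M]

/-- The derivative of an inverse chart, with the tangent spaces of `M` read as `ℂ^m`. -/
def chartDeriv (e : OpenPartialHomeomorph M (CSpace m)) (z : CSpace m) :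
    CSpace m →L[ℂ] CSpace m :=
  mfderiv 𝓘(ℂ, CSpace m) 𝓘(ℂ, CSpace m) e.symm z

/-- The value at `x` of a field of sesquilinear forms, with the tangent space read as `ℂ^m`. -/
def formAt
    (h : ∀ x : M, TangentSpace 𝓘(ℂ, CSpace m) x →ₗ[ℂ] TangentSpace 𝓘(ℂ, CSpace m) x →ₗ⋆[ℂ] ℂ)
    (x : M) : CSpace m →ₗ[ℂ] CSpace m →ₗ⋆[ℂ] ℂ :=
  h x

theorem formMatrix_apply
    (h : ∀ x : M, TangentSpace 𝓘(ℂ, CSpace m) x →ₗ[ℂ] TangentSpace 𝓘(ℂ, CSpace m) x →ₗ⋆[ℂ] ℂ)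
    (i j : Fin m) :
    formMatrix h e z i j = formAt h (e.symm z) (chartDeriv e z (EuclideanSpace.single i 1))
      (chartDeriv e z (EuclideanSpace.single j 1)) :=
  rfl

theorem formAt_chartDeriv
    (h : ∀ x : M, TangentSpace 𝓘(ℂ, CSpace m) x →ₗ[ℂ] TangentSpace 𝓘(ℂ, CSpace m) x →ₗ⋆[ℂ] ℂ)
    (v w : CSpace m) :
    formAt h (e.symm z) (chartDeriv e z v) (chartDeriv e z w) =
      ∑ i, ∑ j, formMatrix h e z i j * v i * conj (w j) := by
  conv_lhs => rw [vec_eq_sum_single v, vec_eq_sum_single w]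
  simp only [map_sum, LinearMap.sum_apply, map_smul, map_smulₛₗ, LinearMap.smul_apply, smul_eq_mul,
    ← formMatrix_apply]
  rw [Finset.sum_comm]
  refine Finset.sum_congr rfl fun j _ => ?_
  rw [Finset.mul_sum]
  refine Finset.sum_congr rfl fun i _ => ?_
  ring

theorem contDiffAt_comp_symm_chartAt {u : M → ℝ} {k : WithTop ℕ∞}
    (hu : ContMDiff 𝓘(ℝ, CSpace m) 𝓘(ℝ) k u) (x : M) :
    ContDiffAt ℝ k (fun y => u ((chartAt (CSpace m) x).symm y)) (chartAt (CSpace m) x x) := by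
  have h := (contMDiffAt_iff.1 (hu x)).2
  simpa [Function.comp_def, contDiffWithinAt_univ, chartAt_self_eq] using h

theorem KahlerMetric.isHermitian (g : KahlerMetric m M) (z : CSpace m) :
    (g.matrix e z).IsHermitian := by
  ext i j
  exact g.conj_symm _ _ _

end PlainCharts

/-! ### Independence of the holomorphic chart -/

section Charts

variable {m : ℕ} {M : Type*} [TopologicalSpace M] [ChartedSpace (CSpace m) M]
  [IsManifold 𝓘(ℂ, CSpace m) ω M] {e e' : OpenPartialHomeomorph M (CSpace m)} {z : CSpace m}

theorem contDiffAt_transition (he : e ∈ atlas (CSpace m) M) (he' : e' ∈ atlas (CSpace m) M)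
    (hz : z ∈ e.target) (hz' : e.symm z ∈ e'.source) :
    ContDiffAt ℂ ω (fun y => e' (e.symm y)) z := by
  have h1 := contMDiffAt_symm_of_mem_maximalAtlas (I := 𝓘(ℂ, CSpace m)) (n := ω)
    (IsManifold.subset_maximalAtlas he) hz
  have h2 := contMDiffAt_of_mem_maximalAtlas (I := 𝓘(ℂ, CSpace m)) (n := ω)
    (IsManifold.subset_maximalAtlas he') hz'
  exact (h2.comp z h1).contDiffAt

theorem chartDeriv_transition (he : e ∈ atlas (CSpace m) M) (he' : e' ∈ atlas (CSpace m) M)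
    (hz : z ∈ e.target) (hz' : e.symm z ∈ e'.source) :
    chartDeriv e z = (chartDeriv e' (e' (e.symm z))).comp
      (fderiv ℂ (fun y => e' (e.symm y)) z) := by
  set τ : CSpace m → CSpace m := fun y => e' (e.symm y) with hτ
  have d1 : MDifferentiableAt 𝓘(ℂ, CSpace m) 𝓘(ℂ, CSpace m) e'.symm (τ z) :=
    mdifferentiableAt_atlas_symm he' (e'.map_source hz')
  have d2 : DifferentiableAt ℂ τ z :=
    (contDiffAt_transition he he' hz hz').differentiableAt (by simp)
  have ev : e.symm =ᶠ[𝓝 z] e'.symm ∘ τ := by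
    have : ∀ᶠ y in 𝓝 z, e.symm y ∈ e'.source :=
      (e.continuousAt_symm hz).eventually (e'.open_source.mem_nhds hz')
    filter_upwards [this] with y hy
    exact (e'.left_inv hy).symm
  have h : mfderiv 𝓘(ℂ, CSpace m) 𝓘(ℂ, CSpace m) (e'.symm ∘ τ) z =
      (mfderiv 𝓘(ℂ, CSpace m) 𝓘(ℂ, CSpace m) e'.symm (τ z)).comp
        (mfderiv 𝓘(ℂ, CSpace m) 𝓘(ℂ, CSpace m) τ z) :=
    mfderiv_comp z d1 d2.mdifferentiableAt
  rw [mfderiv_eq_fderiv] at h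
  exact (ev.mfderiv_eq).trans h

/-- Both the metric and the complex Hessian transform by the same congruence, so the determinants
and traces built from them can be compared in different charts. -/
theorem formMatrix_transition
    (h : ∀ x : M, TangentSpace 𝓘(ℂ, CSpace m) x →ₗ[ℂ] TangentSpace 𝓘(ℂ, CSpace m) x →ₗ⋆[ℂ] ℂ)
    (he : e ∈ atlas (CSpace m) M) (he' : e' ∈ atlas (CSpace m) M)
    (hz : z ∈ e.target) (hz' : e.symm z ∈ e'.source) :
    formMatrix h e z = (jacobian (fun y => e' (e.symm y)) z)ᵀ *
      formMatrix h e' (e' (e.symm z)) * (jacobian (fun y => e' (e.symm y)) z).map conj := by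
  ext i j
  have hx : e.symm z = e'.symm (e' (e.symm z)) := (e'.left_inv hz').symm
  rw [formMatrix_apply, chartDeriv_transition he he' hz hz', ContinuousLinearMap.comp_apply,
    ContinuousLinearMap.comp_apply]
  conv_lhs => rw [show formAt h (e.symm z) = formAt h (e'.symm (e' (e.symm z))) from by rw [← hx]]
  rw [formAt_chartDeriv, Finset.sum_comm]
  simp only [Matrix.mul_apply, Matrix.transpose_apply, Matrix.map_apply, Finset.sum_mul]
  refine Finset.sum_congr rfl fun l _ => Finset.sum_congr rfl fun k _ => ?_
  simp only [jacobian, Matrix.of_apply]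
  ring

theorem contDiffAt_comp_symm_transition {u : M → ℝ} {k : WithTop ℕ∞}
    (he : e ∈ atlas (CSpace m) M) (he' : e' ∈ atlas (CSpace m) M)
    (hz : z ∈ e.target) (hz' : e.symm z ∈ e'.source)
    (hu : ContDiffAt ℝ k (fun y => u (e'.symm y)) (e' (e.symm z))) :
    ContDiffAt ℝ k (fun y => u (e.symm y)) z := by
  have h1 := ((contDiffAt_transition he he' hz hz').restrict_scalars ℝ).of_le
    (le_top : k ≤ ω)
  have h2 : ContDiffAt ℝ k (fun y => u (e'.symm (e' (e.symm y)))) z :=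
    ContDiffAt.comp z (g := fun y => u (e'.symm y)) (f := fun y => e' (e.symm y)) hu h1
  exact h2.congr_of_eventuallyEq (comp_symm_eventuallyEq u hz hz')

theorem complexHessian_transition {u : M → ℝ} (he : e ∈ atlas (CSpace m) M)
    (he' : e' ∈ atlas (CSpace m) M) (hz : z ∈ e.target) (hz' : e.symm z ∈ e'.source)
    (hu : ContDiffAt ℝ 2 (fun y => u (e'.symm y)) (e' (e.symm z))) :
    complexHessian e u z = (jacobian (fun y => e' (e.symm y)) z)ᵀ *
      complexHessian e' u (e' (e.symm z)) * (jacobian (fun y => e' (e.symm y)) z).map conj := by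
  ext i j
  have ev : (fun y => ((u (e.symm y) : ℝ) : ℂ)) =ᶠ[𝓝 z]
      fun y => ((u (e'.symm (e' (e.symm y))) : ℝ) : ℂ) :=
    (comp_symm_eventuallyEq u hz hz').fun_comp Complex.ofReal
  have h := dz_dzbar_comp_holomorphic (τ := fun y => e' (e.symm y)) hu.ofReal_comp
    ((contDiffAt_transition he he' hz hz').of_le le_top) i j
  rw [complexHessian, Matrix.of_apply, complexHessian, ← h, dz_eq_wirt, dz_eq_wirt, dzbar_eq_wirt,
    dzbar_eq_wirt]
  exact wirt_congr (wirt_congr_eventually ev)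

theorem contDiffAt_comp_symm {u : M → ℝ} {k : WithTop ℕ∞}
    (hu : ContMDiff 𝓘(ℝ, CSpace m) 𝓘(ℝ) k u) (he : e ∈ atlas (CSpace m) M) (hz : z ∈ e.target) :
    ContDiffAt ℝ k (fun y => u (e.symm y)) z :=
  contDiffAt_comp_symm_transition he (chart_mem_atlas (CSpace m) (e.symm z)) hz
    (mem_chart_source (CSpace m) (e.symm z)) (contDiffAt_comp_symm_chartAt hu _)

variable (g : KahlerMetric m M)

theorem KahlerMetric.posDef (he : e ∈ atlas (CSpace m) M) (hz : z ∈ e.target) :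
    (g.matrix e z).PosDef := by
  refine .of_dotProduct_mulVec_pos (g.isHermitian z) fun ξ hξ => ?_
  have hinj : Function.Injective (chartDeriv e z) :=
    (mdifferentiable_of_mem_atlas (I := 𝓘(ℂ, CSpace m)) he).symm.mfderiv_injective hz
  -- The conjugate is needed because the matrix quadratic form conjugates the first index, while the
  -- metric conjugates its second argument.
  set η : CSpace m := WithLp.toLp 2 fun i => conj (ξ i) with hη
  have hη0 : chartDeriv e z η ≠ 0 := by
    rw [Ne, map_eq_zero_iff _ hinj]
    intro h
    apply hξ
    ext i
    have := congrArg (fun v : CSpace m => v i) h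
    simpa [hη] using this
  have e1 : star ξ ⬝ᵥ (g.matrix e z *ᵥ ξ) =
      formAt g.form (e.symm z) (chartDeriv e z η) (chartDeriv e z η) := by
    rw [formAt_chartDeriv]
    simp only [dotProduct, Matrix.mulVec, Finset.mul_sum]
    refine Finset.sum_congr rfl fun i _ => Finset.sum_congr rfl fun j _ => ?_
    simp only [hη, Complex.conj_conj, Pi.star_apply, RCLike.star_def, KahlerMetric.matrix]
    ring
  rw [e1, Complex.lt_def]
  refine ⟨g.pos _ _ hη0, ?_⟩
  exact (Complex.conj_eq_iff_im.1 (g.conj_symm _ _ _)).symm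

/-- The Laplacian may be computed in any holomorphic chart. -/
theorem KahlerMetric.laplacian_eq {u : M → ℝ} (he : e ∈ atlas (CSpace m) M) (hz : z ∈ e.target)
    (hu : ContDiffAt ℝ 2 (fun y => u (e.symm y)) z) :
    g.laplacian u (e.symm z) = ((g.matrix e z)⁻¹ * complexHessian e u z).trace.re := by
  set x := e.symm z with hx
  set e' := chartAt (CSpace m) x with he'
  have he'a : e' ∈ atlas (CSpace m) M := chart_mem_atlas (CSpace m) x
  have hxs : x ∈ e'.source := mem_chart_source (CSpace m) x
  have hez : e x = z := e.right_inv hz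
  have hxe : x ∈ e.source := e.map_target hz
  have hu' : ContDiffAt ℝ 2 (fun y => u (e'.symm y)) (e' x) := by
    refine contDiffAt_comp_symm_transition he'a he (e'.map_source hxs) ?_ ?_
    · rw [e'.left_inv hxs]; exact hxe
    · rw [e'.left_inv hxs, hez]; exact hu
  have hG := formMatrix_transition g.form he he'a hz hxs
  have hH := complexHessian_transition he he'a hz hxs hu'
  set J := jacobian (fun y => e' (e.symm y)) z with hJ
  have hdet : (g.matrix e z).det ≠ 0 := (g.posDef he hz).det_pos.ne'
  have hG' : g.matrix e z = Jᵀ * g.matrix e' (e' x) * J.map conj := hG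
  have hJ1 : IsUnit (Jᵀ).det := by
    rw [isUnit_iff_ne_zero]
    intro h
    apply hdet
    rw [hG', Matrix.det_mul, Matrix.det_mul, h, zero_mul, zero_mul]
  have hJ2 : IsUnit (J.map conj).det := by
    rw [isUnit_iff_ne_zero]
    intro h
    apply hdet
    rw [hG', Matrix.det_mul, h, mul_zero]
  rw [hG', hH, Matrix.mul_inv_rev, Matrix.mul_inv_rev, KahlerMetric.laplacian]
  congr 1
  -- The transposed Jacobians cancel here; the conjugated ones form a similarity, which the trace
  -- does not see.
  have e1 : (J.map conj)⁻¹ * ((g.matrix e' (e' x))⁻¹ * Jᵀ⁻¹) *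
      (Jᵀ * complexHessian e' u (e' x) * J.map conj) =
      (J.map conj)⁻¹ * ((g.matrix e' (e' x))⁻¹ * complexHessian e' u (e' x) * J.map conj) := by
    simp only [Matrix.mul_assoc]
    rw [Matrix.nonsing_inv_mul_cancel_left _ _ hJ1]
  rw [e1, Matrix.trace_mul_comm (J.map conj)⁻¹, Matrix.mul_assoc,
    Matrix.mul_nonsing_inv _ hJ2, Matrix.mul_one]

end Charts

/-! ### Hermitian forms and simultaneous diagonalization -/

section HermitianForms

variable {m : ℕ}

/-- The Hermitian form `∑ A_{i j̄} vⁱ v̄ʲ`. -/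
def hermForm (A : Matrix (Fin m) (Fin m) ℂ) (v : Fin m → ℂ) : ℂ :=
  ∑ i, ∑ j, A i j * v i * conj (v j)

theorem mul_mul_conjTranspose_apply (V A : Matrix (Fin m) (Fin m) ℂ) (a b : Fin m) :
    (V * A * Vᴴ) a b = ∑ i, ∑ j, A i j * V a i * conj (V b j) := by
  simp only [Matrix.mul_apply, Matrix.conjTranspose_apply, Finset.sum_mul, RCLike.star_def]
  rw [Finset.sum_comm]
  exact Finset.sum_congr rfl fun i _ => Finset.sum_congr rfl fun j _ => by ring

theorem hermForm_row (V A : Matrix (Fin m) (Fin m) ℂ) (a : Fin m) :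
    hermForm A (V a) = (V * A * Vᴴ) a a :=
  (mul_mul_conjTranspose_apply V A a a).symm

theorem hermForm_eq_dotProduct (A : Matrix (Fin m) (Fin m) ℂ) (v : Fin m → ℂ) :
    hermForm A v = (v ᵥ* A) ⬝ᵥ star v := by
  simp only [hermForm, dotProduct, Matrix.vecMul, Finset.sum_mul, Pi.star_apply, RCLike.star_def]
  rw [Finset.sum_comm]
  exact Finset.sum_congr rfl fun i _ => Finset.sum_congr rfl fun j _ => by ring

theorem hermForm_vecMul (V A : Matrix (Fin m) (Fin m) ℂ) (w : Fin m → ℂ) :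
    hermForm A (w ᵥ* V) = hermForm (V * A * Vᴴ) w := by
  rw [hermForm_eq_dotProduct, hermForm_eq_dotProduct, Matrix.star_vecMul, Matrix.vecMul_vecMul,
    Matrix.dotProduct_mulVec, Matrix.vecMul_vecMul]

theorem hermForm_diagonal (μ : Fin m → ℝ) (w : Fin m → ℂ) :
    hermForm (Matrix.diagonal fun i => (μ i : ℂ)) w = ((∑ i, μ i * ‖w i‖ ^ 2 : ℝ) : ℂ) := by
  simp only [hermForm, Matrix.diagonal_apply, ite_mul, zero_mul, Finset.sum_ite_eq,
    Finset.mem_univ, if_true]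
  push_cast
  refine Finset.sum_congr rfl fun i _ => ?_
  rw [mul_assoc, Complex.mul_conj, Complex.normSq_eq_norm_sq]
  push_cast
  ring

theorem hermForm_add (A B : Matrix (Fin m) (Fin m) ℂ) (v : Fin m → ℂ) :
    hermForm (A + B) v = hermForm A v + hermForm B v := by
  simp only [hermForm, Matrix.add_apply, add_mul, Finset.sum_add_distrib]

/-- Two positive definite Hermitian matrices are simultaneously diagonalizable by congruence. -/
theorem exists_simultaneous_diagonalization {G W : Matrix (Fin m) (Fin m) ℂ} (hG : G.PosDef)
    (hW : W.PosDef) : ∃ (V : Matrix (Fin m) (Fin m) ℂ) (μ : Fin m → ℝ), (∀ i, 0 < μ i) ∧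
      V * G * Vᴴ = 1 ∧ V * W * Vᴴ = Matrix.diagonal fun i => (μ i : ℂ) := by
  have conj_diag : ∀ {X : Matrix (Fin m) (Fin m) ℂ}, X.PosDef → ∃ (U : Matrix (Fin m) (Fin m) ℂ)
      (μ : Fin m → ℝ), (∀ i, 0 < μ i) ∧ U * Uᴴ = 1 ∧
      U * X * Uᴴ = Matrix.diagonal fun i => (μ i : ℂ) := by
    intro X hX
    refine ⟨star (hX.1.eigenvectorUnitary : Matrix (Fin m) (Fin m) ℂ), hX.1.eigenvalues,
      hX.eigenvalues_pos, ?_, ?_⟩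
    · rw [← Matrix.star_eq_conjTranspose, star_star]
      exact Unitary.coe_star_mul_self _
    · have h := hX.1.conjStarAlgAut_star_eigenvectorUnitary
      rw [Unitary.conjStarAlgAut_apply] at h
      exact h
  obtain ⟨U, ν, hν, -, hUG⟩ := conj_diag hG
  -- Rescaling the eigenvectors turns `G` into the identity; the later unitary change `U₂`
  -- diagonalizes `W` without disturbing this.
  set S : Matrix (Fin m) (Fin m) ℂ := Matrix.diagonal fun i => (((√(ν i))⁻¹ : ℝ) : ℂ) with hS
  have hSG : (S * U) * G * (S * U)ᴴ = 1 := by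
    have hSH : Sᴴ = S := by
      rw [hS, Matrix.diagonal_conjTranspose]
      congr 1
      funext i
      exact Complex.conj_ofReal _
    calc (S * U) * G * (S * U)ᴴ = S * (U * G * Uᴴ) * S := by
          rw [Matrix.conjTranspose_mul, hSH]; simp only [Matrix.mul_assoc]
      _ = 1 := by
        rw [hUG, hS, Matrix.diagonal_mul_diagonal, Matrix.diagonal_mul_diagonal,
          ← Matrix.diagonal_one]
        congr 1
        funext i
        have h0 : √(ν i) ≠ 0 := (Real.sqrt_pos.2 (hν i)).ne'
        have : (√(ν i))⁻¹ * ν i * (√(ν i))⁻¹ = 1 := by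
          have h1 := Real.mul_self_sqrt (hν i).le
          field_simp
          nlinarith
        exact_mod_cast this
  set V₁ := S * U with hV₁
  have hV₁u : IsUnit V₁ := by
    have : V₁ * (G * V₁ᴴ) = 1 := by rw [← Matrix.mul_assoc, hSG]
    exact IsUnit.of_mul_eq_one _ this
  have hW₁ : (V₁ * W * V₁ᴴ).PosDef := by
    have := hW.conjTranspose_mul_mul_same (B := V₁ᴴ) (Matrix.mulVec_injective_of_isUnit
      ((Matrix.isUnit_conjTranspose _).2 hV₁u))
    simpa using this
  obtain ⟨U₂, μ, hμ, hU₂, hUW⟩ := conj_diag hW₁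
  refine ⟨U₂ * V₁, μ, hμ, ?_, ?_⟩
  · rw [Matrix.conjTranspose_mul]
    calc U₂ * V₁ * G * (V₁ᴴ * U₂ᴴ) = U₂ * (V₁ * G * V₁ᴴ) * U₂ᴴ := by simp only [Matrix.mul_assoc]
      _ = 1 := by rw [hSG, Matrix.mul_one, hU₂]
  · rw [Matrix.conjTranspose_mul, ← hUW]
    simp only [Matrix.mul_assoc]

section Diagonalized

variable {G W V : Matrix (Fin m) (Fin m) ℂ}

theorem isUnit_of_mul_mul_conjTranspose_eq_one (h : V * G * Vᴴ = 1) : IsUnit V := by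
  have : V * (G * Vᴴ) = 1 := by rw [← Matrix.mul_assoc, h]
  exact IsUnit.of_mul_eq_one _ this

theorem inv_eq_conjTranspose_mul_self (h : V * G * Vᴴ = 1) : G⁻¹ = Vᴴ * V := by
  have h1 : V * (G * Vᴴ) = 1 := by rw [← Matrix.mul_assoc, h]
  have h2 : G * Vᴴ * V = 1 := mul_eq_one_comm.1 h1
  exact Matrix.inv_eq_right_inv (by rw [← Matrix.mul_assoc, h2])

theorem trace_inv_mul_eq (h : V * G * Vᴴ = 1) (X : Matrix (Fin m) (Fin m) ℂ) :
    (G⁻¹ * X).trace = (V * X * Vᴴ).trace := by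
  rw [inv_eq_conjTranspose_mul_self h, Matrix.mul_assoc, Matrix.trace_mul_comm]

end Diagonalized

/-- In a simultaneously diagonalizing frame this is `∑ μ_i |w_i|² ≤ (∑ μ_i) ∑ |w_i|²`. It lets the
trace of `W`, that is `m + Δφ`, control the full complex Hessian of `φ`. -/
theorem hermForm_le_trace_mul {G W : Matrix (Fin m) (Fin m) ℂ} (hG : G.PosDef)
    (hW : W.PosDef) (v : Fin m → ℂ) : 0 ≤ (hermForm W v).re ∧
      (hermForm W v).re ≤ (G⁻¹ * W).trace.re * (hermForm G v).re ∧ 0 ≤ (hermForm G v).re := by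
  obtain ⟨V, μ, hμ, h1, h2⟩ := exists_simultaneous_diagonalization hG hW
  have hu : IsUnit V.det := (Matrix.isUnit_iff_isUnit_det _).1
    (isUnit_of_mul_mul_conjTranspose_eq_one h1)
  obtain ⟨w, rfl⟩ : ∃ w, v = w ᵥ* V := ⟨v ᵥ* V⁻¹, by
    rw [Matrix.vecMul_vecMul, Matrix.nonsing_inv_mul _ hu, Matrix.vecMul_one]⟩
  have h1' : V * G * Vᴴ = Matrix.diagonal fun _ => ((1 : ℝ) : ℂ) := by
    rw [h1]; simp [Matrix.diagonal_one]
  rw [hermForm_vecMul, hermForm_vecMul, trace_inv_mul_eq h1, h2, h1', hermForm_diagonal,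
    hermForm_diagonal (fun _ => 1), Matrix.trace_diagonal, Complex.ofReal_re, Complex.ofReal_re,
    ← Complex.ofReal_sum, Complex.ofReal_re, Finset.mul_sum]
  refine ⟨Finset.sum_nonneg fun i _ => mul_nonneg (hμ i).le (by positivity),
    Finset.sum_le_sum fun i _ => ?_, Finset.sum_nonneg fun i _ => by positivity⟩
  rw [one_mul]
  gcongr
  exact Finset.single_le_sum (fun j _ => (hμ j).le) (Finset.mem_univ i)

end HermitianForms

/-! ### Derivatives and curvature in a constant frame -/

section Frames

variable {m : ℕ} {z : CSpace m}

/-- The vector of `ℂ^m` given by a row of the matrix `V`. -/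
def frame (V : Matrix (Fin m) (Fin m) ℂ) (a : Fin m) : CSpace m := WithLp.toLp 2 (V a)

theorem wirt_wirt_eq_sum {F : CSpace m → ℂ} (hF : ContDiffAt ℝ 2 F z) (v w : CSpace m) :
    wirt (-Complex.I) v (wirt Complex.I w F) z =
      ∑ i, ∑ j, dz i (dzbar j F) z * v i * conj (w j) := by
  have e1 : wirt Complex.I w F = fun y => ∑ j, conj (w j) * dzbar j F y := by
    funext y
    exact wirt_anti_eq_sum w F y
  have hd : ∀ j, DifferentiableAt ℝ (dzbar j F) z := fun j => by
    rw [dzbar_eq_wirt]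
    exact (hF.wirt (k := 1) (by norm_num)).differentiableAt (by norm_num)
  rw [e1, wirt_sum _ fun j _ => (hd j).const_mul _, Finset.sum_comm]
  refine Finset.sum_congr rfl fun j _ => ?_
  rw [wirt_const_mul _ (hd j), wirt_holo_eq_sum, Finset.mul_sum]
  exact Finset.sum_congr rfl fun i _ => by ring

theorem contDiffAt_dz_dzbar {F : CSpace m → ℂ} (hF : ContDiffAt ℝ 4 F z) (i j : Fin m) :
    ContDiffAt ℝ 2 (dz i (dzbar j F)) z := by
  rw [dz_eq_wirt, dzbar_eq_wirt]
  exact (hF.wirt (k := 3) (by norm_num)).wirt (by norm_num)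

theorem dz_dz_dzbar_symm {F : CSpace m → ℂ} (hF : ContDiffAt ℝ 4 F z) (i j k : Fin m) :
    dz k (dz i (dzbar j F)) z = dz i (dz k (dzbar j F)) z := by
  simp only [dz_eq_wirt, dzbar_eq_wirt]
  exact wirt_comm ((hF.wirt (k := 3) (by norm_num)).of_le (by norm_num))

variable {A : CSpace m → Matrix (Fin m) (Fin m) ℂ} (V : Matrix (Fin m) (Fin m) ℂ)

theorem contDiffAt_frame {k : WithTop ℕ∞} (hA : ∀ i j, ContDiffAt ℝ k (fun y => A y i j) z)
    (i j : Fin m) : ContDiffAt ℝ k (fun y => (V * A y * Vᴴ) i j) z :=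
  ContDiffAt.matrix_mul (A := fun y => V * A y) (B := fun _ => Vᴴ)
    (ContDiffAt.matrix_mul (A := fun _ => V) (fun _ _ => contDiffAt_const) hA)
    (fun _ _ => contDiffAt_const) i j

/-- The frame has constant coefficients, so it amounts to a linear change of coordinates and
preserves the Kähler symmetry. -/
theorem frame_closed (hA : ∀ i j, DifferentiableAt ℝ (fun y => A y i j) z)
    (hK : ∀ i j k, dz k (fun y => A y i j) z = dz i (fun y => A y k j) z) (i j k : Fin m) :
    wirtM (-Complex.I) (frame V k) (fun y => V * A y * Vᴴ) z i j =
      wirtM (-Complex.I) (frame V i) (fun y => V * A y * Vᴴ) z k j := by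
  rw [wirtM_const_mul_mul_const _ _ hA, wirtM_const_mul_mul_const _ _ hA,
    mul_mul_conjTranspose_apply, mul_mul_conjTranspose_apply]
  simp only [wirtM, Matrix.of_apply, wirt_holo_eq_sum, frame, Finset.sum_mul]
  have e : ∀ a b : Fin m, ∑ p, ∑ q, ∑ l, V a l * dz l (fun y => A y p q) z * V b p * conj (V j q) =
      ∑ q, ∑ p, ∑ l, V a l * dz l (fun y => A y p q) z * V b p * conj (V j q) := fun a b =>
    Finset.sum_comm
  rw [e, e]
  refine Finset.sum_congr rfl fun q _ => ?_
  rw [Finset.sum_comm]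
  refine Finset.sum_congr rfl fun l _ => Finset.sum_congr rfl fun p _ => ?_
  rw [hK p q l]
  ring

theorem sum_sum_sum_sum_comm {ι : Type*} [Fintype ι] (T : ι → ι → ι → ι → ℂ) :
    ∑ p, ∑ q, ∑ k, ∑ l, T p q k l = ∑ k, ∑ l, ∑ p, ∑ q, T p q k l := by
  calc ∑ p, ∑ q, ∑ k, ∑ l, T p q k l = ∑ x : ι × ι, ∑ y : ι × ι, T x.1 x.2 y.1 y.2 := by
        simp only [Fintype.sum_prod_type]
    _ = ∑ y : ι × ι, ∑ x : ι × ι, T x.1 x.2 y.1 y.2 := Finset.sum_comm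
    _ = _ := by simp only [Fintype.sum_prod_type]

/-- Normalization at `z` gives `Vᴴ V = G⁻¹`, so multiplying the first derivatives in the frame
automatically inserts the inverse metric of the curvature formula. -/
theorem frame_curvature {M : Type*} [TopologicalSpace M] [ChartedSpace (CSpace m) M]
    (g : KahlerMetric m M) {e : OpenPartialHomeomorph M (CSpace m)}
    (hg : ∀ i j, ContDiffAt ℝ 2 (fun y => g.matrix e y i j) z) (hV : V * g.matrix e z * Vᴴ = 1)
    (a b : Fin m) :
    (wirtM (-Complex.I) (frame V b) (fun y => V * g.matrix e y * Vᴴ) z *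
        wirtM Complex.I (frame V b) (fun y => V * g.matrix e y * Vᴴ) z -
      wirtM (-Complex.I) (frame V b)
        (wirtM Complex.I (frame V b) fun y => V * g.matrix e y * Vᴴ) z) a a =
    ∑ i, ∑ j, ∑ k, ∑ l,
        g.curvature e z i j k l * V a i * conj (V a j) * V b k * conj (V b l) := by
  have hd : ∀ i j, DifferentiableAt ℝ (fun y => g.matrix e y i j) z := fun i j =>
    (hg i j).differentiableAt (by norm_num)
  have hd' : ∀ i j, DifferentiableAt ℝ
      (fun y => wirtM Complex.I (frame V b) (fun y => g.matrix e y) y i j) z := fun i j =>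
    (ContDiffAt.wirtM (k := 1) hg (by norm_num) i j).differentiableAt (by norm_num)
  have ev : (wirtM Complex.I (frame V b) fun y => V * g.matrix e y * Vᴴ) =ᶠ[𝓝 z]
      fun y => V * wirtM Complex.I (frame V b) (fun y => g.matrix e y) y * Vᴴ := by
    have : ∀ᶠ y in 𝓝 z, ∀ i j, ContDiffAt ℝ 2 (fun y => g.matrix e y i j) y :=
      eventually_all.2 fun i => eventually_all.2 fun j => (hg i j).eventually (by simp)
    filter_upwards [this] with y hy
    exact wirtM_const_mul_mul_const _ _ fun i j => (hy i j).differentiableAt (by norm_num)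
  rw [wirtM_congr ev, wirtM_const_mul_mul_const _ _ hd, wirtM_const_mul_mul_const _ _ hd,
    wirtM_const_mul_mul_const _ _ hd']
  set X := wirtM (-Complex.I) (frame V b) (fun y => g.matrix e y) z with hX
  set Y := wirtM Complex.I (frame V b) (fun y => g.matrix e y) z with hY
  set Z := wirtM (-Complex.I) (frame V b)
    (fun y => wirtM Complex.I (frame V b) (fun y => g.matrix e y) y) z with hZ
  have e1 : V * X * Vᴴ * (V * Y * Vᴴ) - V * Z * Vᴴ =
      V * (X * (g.matrix e z)⁻¹ * Y - Z) * Vᴴ := by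
    rw [inv_eq_conjTranspose_mul_self hV, Matrix.mul_sub, Matrix.sub_mul]
    simp only [Matrix.mul_assoc]
  have hXe : ∀ i q, X i q = ∑ k, V b k * dz k (fun w => g.matrix e w i q) z := fun i q =>
    wirt_holo_eq_sum _ _ _
  have hYe : ∀ p j, Y p j = ∑ l, conj (V b l) * dzbar l (fun w => g.matrix e w p j) z :=
    fun p j => wirt_anti_eq_sum _ _ _
  have hZe : ∀ i j, Z i j = ∑ k, ∑ l, dz k (dzbar l fun w => g.matrix e w i j) z * V b k *
      conj (V b l) := fun i j => wirt_wirt_eq_sum (hg i j) _ _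
  rw [e1, mul_mul_conjTranspose_apply]
  refine Finset.sum_congr rfl fun i _ => Finset.sum_congr rfl fun j _ => ?_
  have e2 : (X * (g.matrix e z)⁻¹ * Y) i j = ∑ k, ∑ l, (∑ p, ∑ q, (g.matrix e z)⁻¹ q p *
      dz k (fun w => g.matrix e w i q) z * dzbar l (fun w => g.matrix e w p j) z) *
      V b k * conj (V b l) := by
    have e3 : (X * (g.matrix e z)⁻¹ * Y) i j = ∑ p, ∑ q, ∑ k, ∑ l, (g.matrix e z)⁻¹ q p *
        dz k (fun w => g.matrix e w i q) z * dzbar l (fun w => g.matrix e w p j) z *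
        V b k * conj (V b l) := by
      simp only [Matrix.mul_apply]
      refine Finset.sum_congr rfl fun p _ => ?_
      rw [Finset.sum_mul]
      refine Finset.sum_congr rfl fun q _ => ?_
      rw [hXe, hYe, Finset.sum_mul, Finset.sum_mul_sum]
      exact Finset.sum_congr rfl fun k _ => Finset.sum_congr rfl fun l _ => by ring
    rw [e3, sum_sum_sum_sum_comm]
    simp only [Finset.sum_mul]
  rw [Matrix.sub_apply, e2, hZe, ← Finset.sum_sub_distrib, Finset.sum_mul, Finset.sum_mul]
  refine Finset.sum_congr rfl fun k _ => ?_
  rw [← Finset.sum_sub_distrib, Finset.sum_mul, Finset.sum_mul]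
  refine Finset.sum_congr rfl fun l _ => ?_
  rw [KahlerMetric.curvature]
  ring

end Frames

/-! ### The inequality at a maximum point -/

section MaximumPoint

variable {m : ℕ}

/-- The difference is the sum of the products `μ_i μ_j` with `i ≠ j`, and `m ≥ 2` makes that sum
nonempty. It is the denominator of the gradient error. -/
theorem sum_sq_lt_sq_sum (hm : 2 ≤ m) (μ : Fin m → ℝ) (hμ : ∀ i, 0 < μ i) :
    0 < (∑ i, μ i) ^ 2 - ∑ i, μ i ^ 2 := by
  have : Nontrivial (Fin m) := Fin.nontrivial_iff_two_le.2 hm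
  rw [sub_pos, sq, Finset.sum_mul]
  refine Finset.sum_lt_sum_of_nonempty Finset.univ_nonempty fun i _ => ?_
  rw [sq]
  refine mul_lt_mul_of_pos_left ?_ (hμ i)
  obtain ⟨j, hj⟩ := exists_ne i
  exact Finset.single_lt_sum hj (Finset.mem_univ i) (Finset.mem_univ j) (hμ j)
    fun k _ _ => (hμ k).le

theorem trace_inv_mul_im_eq_zero {G W : Matrix (Fin m) (Fin m) ℂ} (hG : G.IsHermitian)
    (hW : W.IsHermitian) : (G⁻¹ * W).trace.im = 0 := by
  rw [← Complex.conj_eq_iff_im, starRingEnd_apply, ← Matrix.trace_conjTranspose,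
    Matrix.conjTranspose_mul, hW.eq, hG.inv.eq, Matrix.trace_mul_comm]

variable {M : Type*} [TopologicalSpace M] [ChartedSpace (CSpace m) M]
  {e : OpenPartialHomeomorph M (CSpace m)} {z : CSpace m} (g : KahlerMetric m M) {f φ : M → ℝ}

theorem KahlerMetric.contDiffAt_matrix (he : e ∈ atlas (CSpace m) M) (hz : z ∈ e.target)
    (i j : Fin m) : ContDiffAt ℝ ∞ (fun y => g.matrix e y i j) z :=
  (g.smooth e he i j).contDiffAt (e.open_target.mem_nhds hz)

variable [IsManifold 𝓘(ℂ, CSpace m) ω M]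

theorem contDiffAt_complexHessian (hφ : ContMDiff 𝓘(ℝ, CSpace m) 𝓘(ℝ) 4 φ)
    (he : e ∈ atlas (CSpace m) M) (hz : z ∈ e.target) (i j : Fin m) :
    ContDiffAt ℝ 2 (fun y => complexHessian e φ y i j) z :=
  contDiffAt_dz_dzbar (contDiffAt_comp_symm hφ he hz).ofReal_comp i j

theorem contDiffAt_potential (hφ : ContMDiff 𝓘(ℝ, CSpace m) 𝓘(ℝ) 4 φ)
    (he : e ∈ atlas (CSpace m) M) (hz : z ∈ e.target) (i j : Fin m) :
    ContDiffAt ℝ 2 (fun y => (g.matrix e y + complexHessian e φ y) i j) z :=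
  ((g.contDiffAt_matrix he hz i j).of_le (by norm_cast)).add
    (contDiffAt_complexHessian hφ he hz i j)

theorem trace_potential (hφ : ContMDiff 𝓘(ℝ, CSpace m) 𝓘(ℝ) 4 φ) (hpos : g.PosDefPotential φ)
    (he : e ∈ atlas (CSpace m) M) (hz : z ∈ e.target) :
    ((g.matrix e z)⁻¹ * (g.matrix e z + complexHessian e φ z)).trace =
      ((m + g.laplacian φ (e.symm z) : ℝ) : ℂ) := by
  have hG := g.posDef he hz
  have h1 := trace_inv_mul_im_eq_zero hG.1 (hpos e he z hz).1
  apply Complex.ext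
  · rw [g.laplacian_eq he hz ((contDiffAt_comp_symm hφ he hz).of_le (by norm_num)),
      Matrix.mul_add, Matrix.nonsing_inv_mul _ (isUnit_iff_ne_zero.2 hG.det_pos.ne'),
      Matrix.trace_add, Matrix.trace_one]
    simp
  · rw [h1, Complex.ofReal_im]

/-- The Laplacian is defined in a chart that varies with the point; identifying it with a trace in
one fixed chart gives its smoothness and allows the second derivative test. -/
theorem contDiffAt_laplacian (hφ : ContMDiff 𝓘(ℝ, CSpace m) 𝓘(ℝ) 4 φ)
    (hpos : g.PosDefPotential φ) (he : e ∈ atlas (CSpace m) M) (hz : z ∈ e.target) :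
    ContDiffAt ℝ 2 (fun y => m + g.laplacian φ (e.symm y)) z := by
  have hG := fun i j => (g.contDiffAt_matrix he hz i j).of_le
    (by norm_cast : (2 : WithTop ℕ∞) ≤ ∞)
  have h1 : ContDiffAt ℝ 2 (fun y =>
      ((g.matrix e y)⁻¹ * (g.matrix e y + complexHessian e φ y)).trace) z :=
    ContDiffAt.matrix_trace (ContDiffAt.matrix_mul
      (ContDiffAt.matrix_inv hG (g.posDef he hz).det_pos.ne') (contDiffAt_potential g hφ he hz))
  have h2 : ContDiffAt ℝ 2 (fun y =>
      ((g.matrix e y)⁻¹ * (g.matrix e y + complexHessian e φ y)).trace.re) z :=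
    Complex.reCLM.contDiff.contDiffAt.comp z h1
  refine h2.congr_of_eventuallyEq ?_
  filter_upwards [e.open_target.mem_nhds hz] with y hy
  rw [trace_potential g hφ hpos he hy, Complex.ofReal_re]

/-- The density of a solution of the Monge-Ampère equation is of class `C²`. -/
theorem contDiffAt_density (hφ : ContMDiff 𝓘(ℝ, CSpace m) 𝓘(ℝ) 4 φ)
    (hMA : g.SolvesMongeAmpere f φ) (he : e ∈ atlas (CSpace m) M) (hz : z ∈ e.target) :
    ContDiffAt ℝ 2 (fun y => f (e.symm y)) z := by
  have hG := fun i j => (g.contDiffAt_matrix he hz i j).of_le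
    (by norm_cast : (2 : WithTop ℕ∞) ≤ ∞)
  have h1 : ContDiffAt ℝ 2 (fun y => (g.matrix e y + complexHessian e φ y).det *
      ((g.matrix e y).det)⁻¹) z :=
    (ContDiffAt.matrix_det (contDiffAt_potential g hφ he hz)).mul
      ((ContDiffAt.matrix_det hG).inv (g.posDef he hz).det_pos.ne')
  refine (Complex.reCLM.contDiff.contDiffAt.comp z h1).congr_of_eventuallyEq ?_
  filter_upwards [e.open_target.mem_nhds hz] with y hy
  rw [Function.comp_apply, hMA e he y hy, mul_inv_cancel_right₀ (g.posDef he hy).det_pos.ne',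
    Complex.reCLM_apply, Complex.ofReal_re]

/-- The inequality satisfied at a maximum point of `m + Δφ - δφ`. -/
theorem exists_eigenvalues_at_max (hm : 2 ≤ m) (hg : g.NonnegOrthogonalBisectional)
    {δ A T : ℝ} (hf : ∀ x, 0 < f x) (hφ : ContMDiff 𝓘(ℝ, CSpace m) 𝓘(ℝ) 4 φ)
    (hMA : g.SolvesMongeAmpere f φ) (hpos : g.PosDefPotential φ)
    (he : e ∈ atlas (CSpace m) M) (hz : z ∈ e.target)
    (hA : -A ≤ g.laplacian (fun y => f y ^ (1 / ((m : ℝ) - 1))) (e.symm z))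
    (hmax : ∀ x, g.laplacian φ x - δ * φ x ≤ g.laplacian φ (e.symm z) - δ * φ (e.symm z))
    (hT : ∀ v : CSpace m, hermForm (g.matrix e z) v = 1 →
      ‖wirt (-Complex.I) v (fun y => ((φ (e.symm y) : ℝ) : ℂ)) z‖ ^ 2 ≤ T) :
    ∃ μ : Fin m → ℝ, (∀ i, 0 < μ i) ∧ ∑ i, μ i = m + g.laplacian φ (e.symm z) ∧
      ∏ i, μ i = (f (e.symm z) ^ (1 / ((m : ℝ) - 1))) ^ (m - 1) ∧
      ((m : ℝ) - 1) / (f (e.symm z) ^ (1 / ((m : ℝ) - 1))) * (-A) -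
        m / (((m : ℝ) - 1) * ((∑ i, μ i) ^ 2 - ∑ i, μ i ^ 2)) * (δ ^ 2 * (m * T)) ≤
      δ * (m - ∑ i, (μ i)⁻¹) := by
  have hm' : (2 : ℝ) ≤ m := by exact_mod_cast hm
  have hm1 : ((m - 1 : ℕ) : ℝ) = (m : ℝ) - 1 := by rw [Nat.cast_sub (by omega)]; simp
  -- The exponent `m - 1` in `H^{m-1} = f` is a natural number below and a real one here; `hHpow`
  -- reconciles the two.
  set H : CSpace m → ℝ := fun y => f (e.symm y) ^ (1 / ((m : ℝ) - 1)) with hH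
  have hH0 : ∀ y, 0 < H y := fun y => Real.rpow_pos_of_pos (hf _) _
  have hHpow : ∀ y, H y ^ (m - 1) = f (e.symm y) := fun y => by
    rw [hH, ← Real.rpow_natCast, ← Real.rpow_mul (hf _).le, hm1,
      one_div_mul_cancel (by linarith), Real.rpow_one]
  have hHc : ContDiffAt ℝ 2 H z :=
    (contDiffAt_density g hφ hMA he hz).rpow_const_of_ne (hf _).ne'
  obtain ⟨V, μ, hμ, hVG, hVW⟩ := exists_simultaneous_diagonalization (g.posDef he hz)
    (hpos e he z hz)
  have hE := sum_sq_lt_sq_sum hm μ hμ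
  have hVu : IsUnit V := isUnit_of_mul_mul_conjTranspose_eq_one hVG
  set G : CSpace m → Matrix (Fin m) (Fin m) ℂ := fun y => V * g.matrix e y * Vᴴ with hG
  set W : CSpace m → Matrix (Fin m) (Fin m) ℂ := fun y =>
    V * (g.matrix e y + complexHessian e φ y) * Vᴴ with hW
  set u : CSpace m → ℝ := fun y => m + g.laplacian φ (e.symm y) with hu
  set Φ : CSpace m → ℝ := fun y => φ (e.symm y) with hΦ
  have hgC : ∀ {y}, y ∈ e.target → ∀ i j, ContDiffAt ℝ 2 (fun y => g.matrix e y i j) y :=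
    fun hy i j => (g.contDiffAt_matrix he hy i j).of_le (by norm_cast)
  have hΦC : ∀ {y}, y ∈ e.target → ContDiffAt ℝ 4 Φ y := fun hy => contDiffAt_comp_symm hφ he hy
  have hΦ2 : ContDiffAt ℝ 2 Φ z := (hΦC hz).of_le (by norm_num)
  have huC : ContDiffAt ℝ 2 u z := contDiffAt_laplacian g hφ hpos he hz
  have hnh : ∀ᶠ y in 𝓝 z, y ∈ e.target := e.open_target.mem_nhds hz
  have htr : ∀ y ∈ e.target, ((G y)⁻¹ * W y).trace = (u y : ℂ) := by
    intro y hy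
    rw [← trace_potential g hφ hpos he hy, hG, hW]
    have hd : IsUnit V.det := (Matrix.isUnit_iff_isUnit_det _).1 hVu
    have hd' : IsUnit (Vᴴ).det := (Matrix.isUnit_iff_isUnit_det _).1
      ((Matrix.isUnit_conjTranspose _).2 hVu)
    simp only [Matrix.mul_inv_rev, Matrix.mul_assoc]
    rw [Matrix.nonsing_inv_mul_cancel_left _ _ hd, Matrix.trace_mul_comm, Matrix.mul_assoc,
      Matrix.mul_assoc, Matrix.mul_nonsing_inv _ hd', Matrix.mul_one]
  have htr' : (fun y => ((G y)⁻¹ * W y).trace) =ᶠ[𝓝 z] fun y => (u y : ℂ) := by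
    filter_upwards [hnh] with y hy using htr y hy
  have key := sum_wirt_wirt_trace_ge hm (frame V) z G W H μ hμ
    (contDiffAt_frame V (hgC hz)) (contDiffAt_frame V (contDiffAt_potential g hφ he hz))
    hHc.ofReal_comp (hH0 z)
    (Eventually.of_forall fun y => Matrix.isHermitian_mul_mul_conjTranspose _ (g.isHermitian y))
    (by
      filter_upwards [hnh] with y hy
      exact Matrix.isHermitian_mul_mul_conjTranspose _ (hpos e he y hy).1)
    (by
      filter_upwards [hnh] with y hy
      exact frame_closed V (fun i j => (hgC hy i j).differentiableAt (by norm_num))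
        fun i j k => g.closed e he y hy i j k)
    (by
      filter_upwards [hnh] with y hy
      refine frame_closed V (fun i j =>
        (contDiffAt_potential g hφ he hy i j).differentiableAt (by norm_num)) fun i j k => ?_
      have d1 : ∀ i j, DifferentiableAt ℝ (fun y => g.matrix e y i j) y := fun i j =>
        (hgC hy i j).differentiableAt (by norm_num)
      have d2 : ∀ i j, DifferentiableAt ℝ (fun y => complexHessian e φ y i j) y := fun i j =>
        (contDiffAt_complexHessian hφ he hy i j).differentiableAt (by norm_num)
      have e1 := g.closed e he y hy i j k
      have e2 : dz k (fun y => complexHessian e φ y i j) y =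
          dz i (fun y => complexHessian e φ y k j) y :=
        dz_dz_dzbar_symm (hΦC hy).ofReal_comp i j k
      simp only [Matrix.add_apply, dz_eq_wirt] at e1 e2 ⊢
      rw [wirt_add (d1 i j) (d2 i j), wirt_add (d1 k j) (d2 k j)]
      exact congrArg₂ (· + ·) e1 e2)
    (by
      filter_upwards [hnh] with y hy
      rw [hG, hW]
      simp only [Matrix.det_mul]
      rw [hMA e he y hy, ← hHpow y]
      push_cast
      ring)
    hVG hVW
    (fun a b hab => by
      rw [hG, frame_curvature V g (hgC hz) hVG]
      refine hg e he z hz V (fun a b => ?_) a b hab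
      rw [← mul_mul_conjTranspose_apply, hVG, Matrix.one_apply])
    hE
  have hunit : ∀ a, hermForm (g.matrix e z) (frame V a) = 1 := fun a => by
    have := hermForm_row V (g.matrix e z) a
    rw [hVG, Matrix.one_apply_eq] at this
    exact this
  set R : CSpace m → ℝ := fun y => u y - δ * Φ y with hR
  have hRC : ContDiffAt ℝ 2 R z := huC.sub (contDiffAt_const.mul hΦ2)
  have hRmax : IsLocalMax R z := Eventually.of_forall fun y => by
    have := hmax (e.symm y)
    simp only [hR, hu, hΦ]
    linarith
  have hRfun : (fun y => (R y : ℂ)) = fun y => (u y : ℂ) - δ * (Φ y : ℂ) := by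
    funext y; simp only [hR]; push_cast; ring
  have du : ∀ᶠ y in 𝓝 z, DifferentiableAt ℝ (fun y => (u y : ℂ)) y := by
    filter_upwards [huC.ofReal_comp.eventually (by simp)] with y hy
    exact hy.differentiableAt (by norm_num)
  have dΦ : ∀ᶠ y in 𝓝 z, DifferentiableAt ℝ (fun y => (Φ y : ℂ)) y := by
    filter_upwards [hΦ2.ofReal_comp.eventually (by simp)] with y hy
    exact hy.differentiableAt (by norm_num)
  have hRw : ∀ c v, wirt c v (fun y => (R y : ℂ)) =ᶠ[𝓝 z] fun y =>
      wirt c v (fun y => (u y : ℂ)) y - δ * wirt c v (fun y => (Φ y : ℂ)) y := by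
    intro c v
    filter_upwards [du, dΦ] with y h1 h2
    rw [hRfun, wirt_sub h1 (h2.const_mul _), wirt_const_mul _ h2]
  -- The gradient of `u - δφ` vanishes, so the gradient of the trace is no longer a third order
  -- quantity.
  have hgrad : ∀ k, wirt (-Complex.I) (frame V k) (fun y => ((G y)⁻¹ * W y).trace) z =
      δ * wirt (-Complex.I) (frame V k) (fun y => (Φ y : ℂ)) z := fun k => by
    have h0 : wirt (-Complex.I) (frame V k) (fun y => (R y : ℂ)) z = 0 := by
      rw [wirt_ofReal (hRC.differentiableAt (by norm_num)), hRmax.fderiv_eq_zero]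
      simp
    rw [(hRw _ _).self_of_nhds] at h0
    rw [wirt_congr htr']
    linear_combination h0
  -- In the frame the Hessian of `φ` is `W - G = diag(μ) - 1`. Dividing by `μ_k` and summing
  -- produces the good term `-∑ 1/μ_k`.
  have hΦH : ∀ k, (wirt (-Complex.I) (frame V k)
      (wirt Complex.I (frame V k) fun y => (Φ y : ℂ)) z).re = μ k - 1 := fun k => by
    have h1 : wirt (-Complex.I) (frame V k) (wirt Complex.I (frame V k) fun y => (Φ y : ℂ)) z =
        (V * complexHessian e φ z * Vᴴ) k k := by
      rw [wirt_wirt_eq_sum hΦ2.ofReal_comp, mul_mul_conjTranspose_apply]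
      rfl
    have h2 : V * complexHessian e φ z * Vᴴ = Matrix.diagonal (fun i => (μ i : ℂ)) - 1 := by
      rw [← hVW, ← hVG, ← Matrix.sub_mul, ← Matrix.mul_sub, add_sub_cancel_left]
    rw [h1, h2, Matrix.sub_apply, Matrix.diagonal_apply_eq, Matrix.one_apply_eq]
    simp
  have hsecond : ∀ k, (wirt (-Complex.I) (frame V k)
      (wirt Complex.I (frame V k) fun y => ((G y)⁻¹ * W y).trace) z).re ≤ δ * (μ k - 1) :=
    fun k => by
    have h0 := hRmax.wirt_wirt_re_nonpos (v := frame V k) hRC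
    have c1 : DifferentiableAt ℝ (wirt Complex.I (frame V k) fun y => (u y : ℂ)) z :=
      (huC.ofReal_comp.wirt (k := 1) (by norm_num)).differentiableAt (by norm_num)
    have c2 : DifferentiableAt ℝ (wirt Complex.I (frame V k) fun y => (Φ y : ℂ)) z :=
      (hΦ2.ofReal_comp.wirt (k := 1) (by norm_num)).differentiableAt (by norm_num)
    rw [wirt_congr (hRw _ _), wirt_sub c1 (c2.const_mul _), wirt_const_mul _ c2, Complex.sub_re,
      Complex.re_ofReal_mul, hΦH] at h0
    rw [wirt_congr (wirt_congr_eventually htr')]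
    linarith
  have hlap : ∑ i, (wirt (-Complex.I) (frame V i)
      (wirt Complex.I (frame V i) fun y => (H y : ℂ)) z).re =
      g.laplacian (fun y => f y ^ (1 / ((m : ℝ) - 1))) (e.symm z) := by
    rw [g.laplacian_eq he hz hHc, trace_inv_mul_eq hVG, Matrix.trace, Complex.re_sum]
    refine Finset.sum_congr rfl fun i _ => ?_
    rw [wirt_wirt_eq_sum hHc.ofReal_comp, Matrix.diag_apply, mul_mul_conjTranspose_apply]
    rfl
  rw [hlap] at key
  refine ⟨μ, hμ, ?_, ?_, ?_⟩
  · have h1 := htr z hz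
    rw [hG, hW] at h1
    simp only [hVG, hVW, inv_one, Matrix.one_mul, Matrix.trace_diagonal] at h1
    exact_mod_cast h1
  · have h1 := congrArg Matrix.det hVW
    have h2 := congrArg Matrix.det hVG
    have h3 := hHpow z
    simp only [Matrix.det_mul, Matrix.det_diagonal, Matrix.det_one] at h1 h2
    rw [hMA e he z hz, ← h3] at h1
    have h4 : ((∏ i, μ i : ℝ) : ℂ) = ((H z ^ (m - 1) : ℝ) : ℂ) := by
      rw [Complex.ofReal_prod, ← h1]
      linear_combination ((H z ^ (m - 1) : ℝ) : ℂ) * h2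
    exact Complex.ofReal_injective h4
  · have hn0 : 0 < (m : ℝ) - 1 := by linarith
    have b1 : ((m : ℝ) - 1) / H z * (-A) ≤ ((m : ℝ) - 1) / H z *
        g.laplacian (fun y => f y ^ (1 / ((m : ℝ) - 1))) (e.symm z) :=
      mul_le_mul_of_nonneg_left hA (div_nonneg hn0.le (hH0 z).le)
    have b2 : ∑ i, ‖wirt (-Complex.I) (frame V i) (fun y => ((G y)⁻¹ * W y).trace) z‖ ^ 2 ≤
        δ ^ 2 * (m * T) := by
      calc ∑ i, ‖wirt (-Complex.I) (frame V i) (fun y => ((G y)⁻¹ * W y).trace) z‖ ^ 2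
          ≤ ∑ _i : Fin m, δ ^ 2 * T := Finset.sum_le_sum fun i _ => by
            rw [hgrad, norm_mul, Complex.norm_real, mul_pow, Real.norm_eq_abs, sq_abs]
            exact mul_le_mul_of_nonneg_left (hT _ (hunit i)) (sq_nonneg _)
        _ = δ ^ 2 * (m * T) := by simp; ring
    have b3 := mul_le_mul_of_nonneg_left b2 (div_nonneg (by linarith : (0 : ℝ) ≤ m)
      (mul_pos hn0 hE).le)
    have b4 : ∑ k, (wirt (-Complex.I) (frame V k)
        (wirt Complex.I (frame V k) fun y => ((G y)⁻¹ * W y).trace) z).re / μ k ≤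
        δ * (m - ∑ i, (μ i)⁻¹) := by
      calc _ ≤ ∑ k, δ * (μ k - 1) / μ k := Finset.sum_le_sum fun k _ =>
            div_le_div_of_nonneg_right (hsecond k) (hμ k).le
        _ = ∑ k, (δ - δ * (μ k)⁻¹) := Finset.sum_congr rfl fun k _ => by
            have := (hμ k).ne'
            field_simp
        _ = _ := by
            rw [Finset.sum_sub_distrib, ← Finset.mul_sum]
            simp
            ring
    linarith

end MaximumPoint

/-! ### The gradient of the potential in terms of the largest Laplacian -/

section GradientBound

variable {m : ℕ}

theorem hermForm_pos {A : Matrix (Fin m) (Fin m) ℂ} (hA : A.PosDef) {v : CSpace m} (hv : v ≠ 0) :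
    0 < (hermForm A v).re := by
  have h0 : star (v : Fin m → ℂ) ≠ 0 := by
    intro h
    apply hv
    ext i
    simpa using congrFun h i
  have h := hA.dotProduct_mulVec_pos h0
  rw [star_star, Matrix.dotProduct_mulVec, ← hermForm_eq_dotProduct] at h
  exact (Complex.lt_def.1 h).1

theorem hermForm_real_smul (A : Matrix (Fin m) (Fin m) ℂ) (t : ℝ) (v : CSpace m) :
    (hermForm A (t • v : CSpace m)).re = t ^ 2 * (hermForm A v).re := by
  have : hermForm A (t • v : CSpace m) = ((t ^ 2 : ℝ) : ℂ) * hermForm A v := by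
    simp only [hermForm, PiLp.smul_apply, Complex.real_smul, map_mul, Complex.conj_ofReal,
      Finset.mul_sum]
    refine Finset.sum_congr rfl fun i _ => Finset.sum_congr rfl fun j _ => ?_
    push_cast
    ring
  rw [this, Complex.re_ofReal_mul]

/-- On a compact set a continuous family of positive definite Hermitian forms is uniformly
equivalent to the Euclidean one. -/
theorem exists_hermForm_bounds {G : CSpace m → Matrix (Fin m) (Fin m) ℂ} {s : Set (CSpace m)}
    (hs : IsCompact s) (hc : ∀ i j, ContinuousOn (fun y => G y i j) s)
    (hG : ∀ y ∈ s, (G y).PosDef) : ∃ a b : ℝ, 0 < a ∧ 0 ≤ b ∧ ∀ y ∈ s, ∀ v : CSpace m,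
      a * ‖v‖ ^ 2 ≤ (hermForm (G y) v).re ∧ (hermForm (G y) v).re ≤ b * ‖v‖ ^ 2 := by
  have hcont : ContinuousOn (fun p : CSpace m × CSpace m => (hermForm (G p.1) p.2).re)
      (s ×ˢ Metric.sphere (0 : CSpace m) 1) := by
    refine Complex.continuous_re.comp_continuousOn ?_
    simp only [hermForm]
    refine continuousOn_finsetSum _ fun i _ => continuousOn_finsetSum _ fun j _ => ?_
    have h1 : ContinuousOn (fun p : CSpace m × CSpace m => G p.1 i j)
        (s ×ˢ Metric.sphere (0 : CSpace m) 1) :=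
      (hc i j).comp continuousOn_fst fun p hp => hp.1
    have h2 : ∀ l, Continuous fun p : CSpace m × CSpace m => p.2 l := fun l => by fun_prop
    exact (h1.mul (h2 i).continuousOn).mul
      (Complex.continuous_conj.comp (h2 j)).continuousOn
  have hcomp := hs.prod (isCompact_sphere (0 : CSpace m) 1)
  obtain ⟨a, ha, hal⟩ := hcomp.exists_forall_le' hcont (a := 0) fun p hp =>
    hermForm_pos (hG p.1 hp.1) (by
      have := hp.2
      rintro h0
      rw [h0] at this
      simp at this)
  obtain ⟨b, hb⟩ := hcomp.bddAbove_image hcont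
  -- The bounds on the unit sphere extend to all vectors by homogeneity of degree two.
  refine ⟨a, max b 0, ha, le_max_right _ _, fun y hy v => ?_⟩
  by_cases hv : v = 0
  · subst hv
    simp [hermForm]
  have hn : ‖v‖ ≠ 0 := norm_ne_zero_iff.2 hv
  have hmem : (y, ‖v‖⁻¹ • v) ∈ s ×ˢ Metric.sphere (0 : CSpace m) 1 :=
    ⟨hy, by simp [norm_smul, inv_mul_cancel₀ hn]⟩
  have e1 : (hermForm (G y) v).re = ‖v‖ ^ 2 * (hermForm (G y) (‖v‖⁻¹ • v : CSpace m)).re := by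
    rw [← hermForm_real_smul, smul_inv_smul₀ hn]
  have h1 := hal _ hmem
  have h2 : (hermForm (G y) (‖v‖⁻¹ • v : CSpace m)).re ≤ b := hb ⟨_, hmem, rfl⟩
  rw [e1]
  constructor
  · rw [mul_comm]
    exact mul_le_mul_of_nonneg_left h1 (by positivity)
  · rw [mul_comm]
    exact mul_le_mul_of_nonneg_right (h2.trans (le_max_left _ _)) (by positivity)

variable {M : Type*} [TopologicalSpace M] [ChartedSpace (CSpace m) M]
  [IsManifold 𝓘(ℂ, CSpace m) ω M] (g : KahlerMetric m M)

/-- The gradient bound for potentials of oscillation at most `L` in the chart `e` at the point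
`x₀`: the squared gradient is at most `C` times a bound for `m + Δφ`. -/
def GradientBoundAt (L C : ℝ) (x₀ : M) : Prop :=
  ∃ e ∈ atlas (CSpace m) M, x₀ ∈ e.source ∧ ∀ φ : M → ℝ, ContMDiff 𝓘(ℝ, CSpace m) 𝓘(ℝ) 4 φ →
    (∀ x y, φ x - φ y ≤ L) → g.PosDefPotential φ → ∀ K : ℝ, 1 ≤ K →
    (∀ x, m + g.laplacian φ x ≤ K) → ∀ v : CSpace m, hermForm (g.matrix e (e x₀)) v = 1 →
    ‖wirt (-Complex.I) v (fun y => ((φ (e.symm y) : ℝ) : ℂ)) (e x₀)‖ ^ 2 ≤ C * K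

/-- Positivity of `W` gives `φ_{v v̄} ≥ -g(v,v)`, and `W ≤ K g` gives `φ_{v v̄} ≤ K g(v,v)`; so the
Hessian on each complex line is `O(K)` and interpolation applies. -/
theorem exists_local_gradientBound (L : ℝ) (x : M) :
    ∃ s ∈ 𝓝 x, ∃ C : ℝ, ∀ x₀ ∈ s, GradientBoundAt g L C x₀ := by
  set e := chartAt (CSpace m) x with he
  have hea : e ∈ atlas (CSpace m) M := chart_mem_atlas _ x
  have hxe : x ∈ e.source := mem_chart_source _ x
  obtain ⟨R, hR, hball⟩ := Metric.nhds_basis_closedBall.mem_iff.1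
    (e.open_target.mem_nhds (e.map_source hxe))
  obtain ⟨a, b, ha, hb, hab⟩ := exists_hermForm_bounds (G := g.matrix e)
    (isCompact_closedBall (e x) R)
    (fun i j => ((g.smooth e hea i j).continuousOn).mono hball)
    (fun y hy => g.posDef hea (hball hy))
  set ν := √(a⁻¹) with hν
  have hν0 : 0 < ν := Real.sqrt_pos.2 (inv_pos.2 ha)
  -- Unit vectors have Euclidean length at most `ν`, so a square of half-side `r` reaches at most `2
  -- r ν = R/2` from its centre. Centres within `R/2` of the chart point thus stay in the closed
  -- ball of radius `R`.
  set r := R / (4 * ν) with hr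
  have hr0 : 0 < r := by positivity
  refine ⟨e.source ∩ e ⁻¹' Metric.ball (e x) (R / 2), ?_, (2 * L / r + 2 * (b * ν ^ 2 + 1) * r) ^ 2,
    ?_⟩
  · exact inter_mem (e.open_source.mem_nhds hxe)
      ((e.continuousAt hxe).preimage_mem_nhds (Metric.ball_mem_nhds _ (by positivity)))
  rintro x₀ ⟨hx₀, hx₀b⟩
  refine ⟨e, hea, hx₀, fun φ hφ hL hpos K hK hlap v hv => ?_⟩
  have hx₀b' : dist (e x₀) (e x) < R / 2 := hx₀b
  have hvn : ‖v‖ ≤ ν := by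
    have h1 := (hab (e x₀) (Metric.mem_closedBall.2 (by linarith)) v).1
    rw [hv, Complex.one_re] at h1
    refine Real.le_sqrt_of_sq_le ?_
    rw [inv_eq_one_div, le_div_iff₀ ha]
    linarith
  have hmem : ∀ s t : ℝ, |s| ≤ r → |t| ≤ r →
      e x₀ + s • v + t • (Complex.I • v) ∈ Metric.closedBall (e x) R := by
    intro s t hs ht
    rw [Metric.mem_closedBall]
    have h1 : dist (e x₀ + s • v + t • (Complex.I • v)) (e x₀) ≤ R / 2 := by
      rw [dist_eq_norm, add_assoc, add_sub_cancel_left]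
      calc ‖s • v + t • (Complex.I • v)‖ ≤ ‖s • v‖ + ‖t • (Complex.I • v)‖ := norm_add_le _ _
        _ = |s| * ‖v‖ + |t| * ‖v‖ := by
            rw [norm_smul, norm_smul, norm_smul, Complex.norm_I, one_mul, Real.norm_eq_abs,
              Real.norm_eq_abs]
        _ ≤ r * ν + r * ν := by gcongr
        _ = R / 2 := by rw [hr]; field_simp; ring
    linarith [dist_triangle (e x₀ + s • v + t • (Complex.I • v)) (e x₀) (e x)]
  refine norm_sq_wirt_le (F := fun y => φ (e.symm y)) hr0 hK
    (fun s t hs ht => (contDiffAt_comp_symm hφ hea (hball (hmem s t hs ht))).of_le (by norm_num))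
    (fun s t _ _ => abs_le'.2 ⟨hL _ _, by rw [neg_sub]; exact hL _ _⟩) ?_
  intro s t hs ht
  set y := e x₀ + s • v + t • (Complex.I • v) with hy
  have hyb := hmem s t hs ht
  have hyt := hball hyb
  have hC2 : ContDiffAt ℝ 2 (fun y => φ (e.symm y)) y :=
    (contDiffAt_comp_symm hφ hea hyt).of_le (by norm_num)
  have e1 : wirt (-Complex.I) v (wirt Complex.I v fun y => ((φ (e.symm y) : ℝ) : ℂ)) y =
      hermForm (complexHessian e φ y) v := by
    rw [wirt_wirt_eq_sum hC2.ofReal_comp]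
    rfl
  have e2 : (hermForm (complexHessian e φ y) v).im = 0 := by
    rw [← e1, wirt_wirt_ofReal hC2, Complex.ofReal_im]
  obtain ⟨h1, h2, h3⟩ := hermForm_le_trace_mul (g.posDef hea hyt) (hpos e hea y hyt) v
  rw [trace_potential g hφ hpos hea hyt, Complex.ofReal_re] at h2
  rw [hermForm_add, Complex.add_re] at h1 h2
  have h4 : (hermForm (g.matrix e y) v).re ≤ b * ν ^ 2 :=
    (hab y hyb v).2.trans (by gcongr)
  have h5 : (m + g.laplacian φ (e.symm y)) * (hermForm (g.matrix e y) v).re ≤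
      K * (b * ν ^ 2) := mul_le_mul (hlap _) h4 h3 (by linarith)
  have h6 : b * ν ^ 2 ≤ b * ν ^ 2 * K := le_mul_of_one_le_right (by positivity) hK
  have e3 : hermForm (complexHessian e φ y) v =
      (((hermForm (complexHessian e φ y) v).re : ℝ) : ℂ) :=
    Complex.ext (by simp) (by simp [e2])
  rw [e1, e3, Complex.norm_real, Real.norm_eq_abs, abs_le]
  constructor <;> linarith

theorem exists_gradientBound [CompactSpace M] (L : ℝ) :
    ∃ C : ℝ, 0 < C ∧ ∀ x₀ : M, GradientBoundAt g L C x₀ := by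
  have hmono : ∀ {C C' : ℝ} {x₀ : M}, C ≤ C' → GradientBoundAt g L C x₀ →
      GradientBoundAt g L C' x₀ := by
    rintro C C' x₀ hCC ⟨e, he, hx, h⟩
    refine ⟨e, he, hx, fun φ h1 h2 h3 K hK h4 v hv => (h φ h1 h2 h3 K hK h4 v hv).trans ?_⟩
    exact mul_le_mul_of_nonneg_right hCC (by linarith)
  have h : ∃ C : ℝ, ∀ x₀ ∈ (Set.univ : Set M), GradientBoundAt g L C x₀ := by
    refine isCompact_univ.induction_on (p := fun s => ∃ C : ℝ, ∀ x₀ ∈ s, GradientBoundAt g L C x₀)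
      ⟨0, by simp⟩ (fun s t hst ⟨C, hC⟩ => ⟨C, fun x hx => hC x (hst hx)⟩) ?_ ?_
    · rintro s t ⟨C, hC⟩ ⟨C', hC'⟩
      refine ⟨max C C', ?_⟩
      rintro x (hx | hx)
      · exact hmono (le_max_left _ _) (hC x hx)
      · exact hmono (le_max_right _ _) (hC' x hx)
    · intro x _
      obtain ⟨s, hs, C, hC⟩ := exists_local_gradientBound g L x
      exact ⟨s, mem_nhdsWithin_of_mem_nhds hs, C, hC⟩
  obtain ⟨C, hC⟩ := h
  exact ⟨max C 1, by positivity, fun x => hmono (le_max_left _ _) (hC x trivial)⟩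

end GradientBound

/-! ### From the inequality at the maximum to the bound -/

section Estimate

variable {m : ℕ}

/-- Writing the difference as `∑ μ_j (S - μ_j)` and using `∑ 1/μ ≥ 1/μ_j` gives at least `∑ (S -
μ_j) = (m - 1) S`. It converts the gradient error `K/E` into a multiple of `∑ 1/μ`. -/
theorem sum_le_mul_sum_inv (hm : 2 ≤ m) (μ : Fin m → ℝ) (hμ : ∀ i, 0 < μ i) :
    ∑ i, μ i ≤ ((∑ i, μ i) ^ 2 - ∑ i, μ i ^ 2) * ∑ i, (μ i)⁻¹ := by
  set S := ∑ i, μ i with hS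
  have hm' : (2 : ℝ) ≤ m := by exact_mod_cast hm
  have hS0 : 0 ≤ S := Finset.sum_nonneg fun i _ => (hμ i).le
  have h1 : S ^ 2 - ∑ i, μ i ^ 2 = ∑ j, μ j * (S - μ j) := by
    simp only [mul_sub, Finset.sum_sub_distrib, ← Finset.sum_mul, ← hS, sq]
  rw [h1, Finset.sum_mul]
  calc S ≤ (m - 1) * S := le_mul_of_one_le_left hS0 (by linarith)
    _ = ∑ j, (S - μ j) := by
        rw [Finset.sum_sub_distrib, ← hS]
        simp
        ring
    _ ≤ _ := Finset.sum_le_sum fun j _ => by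
        have hj : μ j ≤ S := Finset.single_le_sum (fun i _ => (hμ i).le) (Finset.mem_univ j)
        have hσ : (μ j)⁻¹ ≤ ∑ i, (μ i)⁻¹ :=
          Finset.single_le_sum (f := fun i => (μ i)⁻¹) (fun i _ => (inv_pos.2 (hμ i)).le)
            (Finset.mem_univ j)
        calc S - μ j = μ j * (S - μ j) * (μ j)⁻¹ := by
              have := (hμ j).ne'
              field_simp
          _ ≤ _ := mul_le_mul_of_nonneg_left hσ (mul_nonneg (hμ j).le (sub_nonneg.2 hj))

/-- The product of the `m - 1` numbers `H/μ_j`, `j ≠ i`, is exactly `μ_i`. This matches the power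
`1/(m-1)` of the density. -/
theorem le_pow_mul_sum_inv (μ : Fin m → ℝ) (hμ : ∀ i, 0 < μ i) {H : ℝ}
    (hH : 0 < H) (hprod : ∏ i, μ i = H ^ (m - 1)) (i : Fin m) :
    μ i ≤ (H * ∑ j, (μ j)⁻¹) ^ (m - 1) := by
  have hcard : (Finset.univ.erase i).card = m - 1 := by
    rw [Finset.card_erase_of_mem (Finset.mem_univ i), Finset.card_univ, Fintype.card_fin]
  have hP : 0 < ∏ j ∈ Finset.univ.erase i, μ j := Finset.prod_pos fun j _ => hμ j
  have h1 : μ i = ∏ j ∈ Finset.univ.erase i, H * (μ j)⁻¹ := by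
    rw [Finset.prod_mul_distrib, Finset.prod_const, hcard, ← hprod,
      ← Finset.mul_prod_erase _ _ (Finset.mem_univ i), Finset.prod_inv_distrib,
      mul_inv_cancel_right₀ hP.ne']
  rw [← hcard, ← Finset.prod_const]
  conv_lhs => rw [h1]
  refine Finset.prod_le_prod (fun j _ => mul_nonneg hH.le (inv_pos.2 (hμ j)).le) fun j _ => ?_
  refine mul_le_mul_of_nonneg_left ?_ hH.le
  exact Finset.single_le_sum (f := fun i => (μ i)⁻¹) (fun i _ => (inv_pos.2 (hμ i)).le)
    (Finset.mem_univ j)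

/-- The inequality at the maximum point bounds the trace. -/
theorem sum_eigenvalues_le (hm : 2 ≤ m) {μ : Fin m → ℝ} (hμ : ∀ i, 0 < μ i) {H A B K δ C : ℝ}
    (hH : 0 < H) (hHB : H ≤ B) (hprod : ∏ i, μ i = H ^ (m - 1)) (hC : 0 < C)
    (hδ : δ = ((m : ℝ) - 1) / (4 * m ^ 2 * C)) (hK : K ≤ 2 * ∑ i, μ i)
    (h : ((m : ℝ) - 1) / H * (-A) - m / (((m : ℝ) - 1) * ((∑ i, μ i) ^ 2 - ∑ i, μ i ^ 2)) *
      (δ ^ 2 * (m * (C * K))) ≤ δ * (m - ∑ i, (μ i)⁻¹)) :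
    ∑ i, μ i ≤ m * (2 / δ * ((m - 1) * |A| + δ * m * B)) ^ (m - 1) := by
  have hm' : (2 : ℝ) ≤ m := by exact_mod_cast hm
  set n : ℝ := (m : ℝ) - 1 with hn
  have hn0 : 0 < n := by rw [hn]; linarith
  have hδ0 : 0 < δ := by rw [hδ]; positivity
  have hE := sum_sq_lt_sq_sum hm μ hμ
  have hSE := sum_le_mul_sum_inv hm μ hμ
  set S := ∑ i, μ i with hS
  set E := S ^ 2 - ∑ i, μ i ^ 2 with hEd
  set σ := ∑ i, (μ i)⁻¹ with hσ
  -- `δ` is chosen so that `2 m² C δ / n = 1/2`; the other half of `δσ` remains available.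
  have h1 : m / (n * E) * (δ ^ 2 * (m * (C * K))) ≤ δ * σ / 2 := by
    calc m / (n * E) * (δ ^ 2 * (m * (C * K)))
        ≤ m / (n * E) * (δ ^ 2 * (m * (C * (2 * (E * σ))))) := by
          gcongr
          linarith
      _ = δ * σ * (2 * m ^ 2 * C * δ / n) := by field_simp
      _ = δ * σ / 2 := by
          rw [hδ]
          field_simp
          ring
  have h2 : n / H * A ≤ n / H * |A| := mul_le_mul_of_nonneg_left (le_abs_self A) (by positivity)
  have h3 : δ * σ / 2 ≤ δ * m + n / H * |A| := by linarith
  -- Multiplying by `H` removes the only division by the density, so its upper bound is enough.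
  have h4 : H * σ ≤ 2 / δ * (n * |A| + δ * m * B) := by
    have h5 : H * σ = 2 / δ * (H * (δ * σ / 2)) := by field_simp
    rw [h5]
    refine mul_le_mul_of_nonneg_left ?_ (by positivity)
    calc H * (δ * σ / 2) ≤ H * (δ * m + n / H * |A|) := mul_le_mul_of_nonneg_left h3 hH.le
      _ = n * |A| + δ * m * H := by field_simp; ring
      _ ≤ n * |A| + δ * m * B := by gcongr
  have hσ0 : 0 ≤ σ := Finset.sum_nonneg fun i _ => (inv_pos.2 (hμ i)).le
  calc S ≤ ∑ _i : Fin m, (2 / δ * (n * |A| + δ * m * B)) ^ (m - 1) :=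
        Finset.sum_le_sum fun i _ => (le_pow_mul_sum_inv μ hμ hH hprod i).trans (by gcongr)
    _ = _ := by simp

variable {M : Type*} [TopologicalSpace M] [ChartedSpace (CSpace m) M]
  [IsManifold 𝓘(ℂ, CSpace m) ω M] (g : KahlerMetric m M) {φ : M → ℝ}

theorem continuous_laplacian (hφ : ContMDiff 𝓘(ℝ, CSpace m) 𝓘(ℝ) 4 φ)
    (hpos : g.PosDefPotential φ) : Continuous fun x => m + g.laplacian φ x := by
  refine continuous_iff_continuousAt.2 fun x => ?_
  set e := chartAt (CSpace m) x
  have hx : x ∈ e.source := mem_chart_source _ x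
  have h1 := (contDiffAt_laplacian g hφ hpos (chart_mem_atlas _ x) (e.map_source hx)).continuousAt
  have h2 : ContinuousAt (fun y => m + g.laplacian φ (e.symm (e y))) x :=
    ContinuousAt.comp (g := fun y => m + g.laplacian φ (e.symm y)) h1 (e.continuousAt hx)
  refine h2.congr ?_
  filter_upwards [e.open_source.mem_nhds hx] with y hy
  rw [e.left_inv hy]

theorem laplacian_add_pos (hm : 2 ≤ m) (hφ : ContMDiff 𝓘(ℝ, CSpace m) 𝓘(ℝ) 4 φ)
    (hpos : g.PosDefPotential φ) (x : M) : 0 < m + g.laplacian φ x := by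
  set e := chartAt (CSpace m) x
  have he : e ∈ atlas (CSpace m) M := chart_mem_atlas _ x
  have hx : x ∈ e.source := mem_chart_source _ x
  have hz := e.map_source hx
  obtain ⟨V, μ, hμ, h1, h2⟩ := exists_simultaneous_diagonalization (g.posDef he hz)
    (hpos e he _ hz)
  have h3 := trace_potential g hφ hpos he hz
  rw [trace_inv_mul_eq h1, h2, Matrix.trace_diagonal, e.left_inv hx] at h3
  have h4 : ∑ i, μ i = m + g.laplacian φ x := by exact_mod_cast h3
  rw [← h4]
  have : Nonempty (Fin m) := ⟨⟨0, by omega⟩⟩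
  exact Finset.sum_pos (fun i _ => hμ i) Finset.univ_nonempty

end Estimate

end

/-! ### The estimate for the Laplacian -/

theorem mainTheorem3 (m : ℕ) (hm : 2 ≤ m) {M : Type*} [TopologicalSpace M] [T2Space M]
    [CompactSpace M] [ChartedSpace (CSpace m) M] [IsManifold 𝓘(ℂ, CSpace m) ω M]
    (g : KahlerMetric m M) (hg : g.NonnegOrthogonalBisectional) (L A Λ : ℝ) :
    ∃ C : ℝ, ∀ f φ : M → ℝ,
      (∀ x, 0 < f x) →
      (∀ x, f x ≤ Λ) →
      (∀ x, -A ≤ g.laplacian (fun y => f y ^ (1 / ((m : ℝ) - 1))) x) →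
      ContMDiff 𝓘(ℝ, CSpace m) 𝓘(ℝ) 4 φ →
      (∀ x y, φ x - φ y ≤ L) →
      g.SolvesMongeAmpere f φ →
      g.PosDefPotential φ →
      ∀ x, |g.laplacian φ x| ≤ C := by
  obtain ⟨C₁, hC₁, hgrad⟩ := exists_gradientBound g L
  have hm' : (2 : ℝ) ≤ m := by exact_mod_cast hm
  have hn0 : 0 < (m : ℝ) - 1 := by linarith
  -- `δ` depends only on `m` and the gradient constant, hence neither on `f` nor on `φ`.
  obtain ⟨δ, hδ⟩ : ∃ δ : ℝ, δ = ((m : ℝ) - 1) / (4 * m ^ 2 * C₁) := ⟨_, rfl⟩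
  have hδ0 : 0 < δ := by rw [hδ]; positivity
  set B : ℝ := Λ ^ (1 / ((m : ℝ) - 1)) with hB
  set D : ℝ := m * (2 / δ * ((m - 1) * |A| + δ * m * B)) ^ (m - 1) with hD
  refine ⟨max (max 1 (2 * (δ * L))) (D + δ * L) + m, fun f φ hf hfΛ hA hφ hL hMA hpos x => ?_⟩
  have : Nonempty M := ⟨x⟩
  have hL0 : 0 ≤ L := by simpa using hL x x
  have hu := continuous_laplacian g hφ hpos
  obtain ⟨x₁, -, hx₁⟩ := isCompact_univ.exists_isMaxOn Set.univ_nonempty hu.continuousOn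
  obtain ⟨x₀, -, hx₀⟩ := isCompact_univ.exists_isMaxOn Set.univ_nonempty
    (hu.sub (continuous_const.mul hφ.continuous : Continuous fun x => δ * φ x)).continuousOn
  have hmax₁ : ∀ y, m + g.laplacian φ y ≤ m + g.laplacian φ x₁ := fun y => hx₁ (Set.mem_univ y)
  have hmax₀ : ∀ y, g.laplacian φ y - δ * φ y ≤ g.laplacian φ x₀ - δ * φ x₀ := fun y => by
    have : m + g.laplacian φ y - δ * φ y ≤ m + g.laplacian φ x₀ - δ * φ x₀ :=
      hx₀ (Set.mem_univ y)
    linarith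
  -- Positivity of `W` already gives `Δφ > -m`, so only the upper bound is at stake.
  suffices hK : m + g.laplacian φ x₁ ≤ max (max 1 (2 * (δ * L))) (D + δ * L) by
    have h1 := laplacian_add_pos g hm hφ hpos x
    have h2 := hmax₁ x
    have h3 : (0 : ℝ) ≤ max (max 1 (2 * (δ * L))) (D + δ * L) :=
      zero_le_one.trans ((le_max_left _ _).trans (le_max_left _ _))
    rw [abs_le]
    constructor <;> linarith
  set K := m + g.laplacian φ x₁ with hKdef
  -- If `K` is large, interpolation is available (`K ≥ 1`) and `K - δL ≥ K/2`, so the trace at the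
  -- maximum of `u - δφ` is comparable with the largest trace.
  by_cases hsmall : K ≤ max 1 (2 * (δ * L))
  · exact hsmall.trans (le_max_left _ _)
  have hsmall' := not_le.1 hsmall
  have hK1 : 1 ≤ K := (le_max_left _ _).trans hsmall'.le
  have hK2 : 2 * (δ * L) ≤ K := (le_max_right _ _).trans hsmall'.le
  obtain ⟨e, he, hxe, hbound⟩ := hgrad x₀
  have hz := e.map_source hxe
  have hez : e.symm (e x₀) = x₀ := e.left_inv hxe
  obtain ⟨μ, hμ, hsum, hprod, hineq⟩ := exists_eigenvalues_at_max g hm hg (δ := δ) (A := A)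
    (T := C₁ * K) hf hφ hMA hpos he hz (hA _) (fun y => by rw [hez]; exact hmax₀ y)
    (hbound φ hφ hL hpos K hK1 hmax₁)
  rw [hez] at hsum hprod hineq
  have hlow : K - δ * L ≤ ∑ i, μ i := by
    have h1 := hmax₀ x₁
    have h2 := mul_le_mul_of_nonneg_left (hL x₁ x₀) hδ0.le
    rw [hsum, hKdef]
    linarith
  have hS := sum_eigenvalues_le hm hμ (Real.rpow_pos_of_pos (hf x₀) _)
    (Real.rpow_le_rpow (hf x₀).le (hfΛ x₀) (by positivity)) hprod hC₁ hδ (by linarith) hineq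
  refine le_trans ?_ (le_max_right _ _)
  linarith
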